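/- Let $N\ge 1$. There are $N+1$ agents. A contest is a vector of prizes $v=(v_0,\dots,v_N)$ with $0\le v_0\le v_1\le\dots\le v_N$. Each agent privately has type $k\in\{1,\dots,K\}$ with probability $p_k>0$ ($\sum_k p_k=1$), independently across agents. Agents simultaneously choose efforts $x\ge 0$; an agent who outperforms exactly $m$ of the $N$ others receives $v_m$, ties being broken uniformly at random, and an agent of type $k$ who receives $v_m$ after effort $x$ has payoff $v_m-c_k(x)$. The type-space is parametric: $c_k(x)=\theta_k\,c(x)$ with $\theta_1>\dots>\theta_K>0$, where $c:[0,\infty)\to[0,\infty)$ is continuous and strictly increasing with $c(0)=0$ and $\lim_{x\to\infty}c(x)=\infty$. Suppose that $c$ is concave, and that $K\ge 2$ or $c$ is strictly concave. Then for every contest $v$ a symmetric (mixed-strategy) Bayes–Nash equilibrium exists, and the ex-ante expected effort $\mathbb E[X]$ of an agent is finite and the same in all symmetric equilibria of $v$. For every budget $V>0$, among all contests $v$ with $\sum_{m=0}^N v_m\le V$, the winner-takes-all contest $v=(0,\dots,0,V)$ uniquely maximizes $\mathbb E[X]$: every other such contest gives a strictly smaller $\mathbb E[X]$. -/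

import Mathlib

open MeasureTheory

noncomputable section

namespace Contest

/-- A contest among `N + 1` agents: nonnegative prizes `v 0 ≤ v 1 ≤ ⋯ ≤ v N`, where `v m` is
the prize of an agent who outperforms exactly `m` of the `N` other agents. -/
structure IsContest {N : ℕ} (v : Fin (N + 1) → ℝ) : Prop where
  nonneg : 0 ≤ v 0
  mono : Monotone v

/-- The winner-takes-all contest `(0, …, 0, V)`. -/
def winnerTakesAll (N : ℕ) (V : ℝ) : Fin (N + 1) → ℝ := Pi.single (Fin.last N) V

/-- A cost function on efforts `x ≥ 0` (values at negative arguments are irrelevant):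
continuous, strictly increasing, zero at zero, and unbounded. -/
structure IsCost (c : ℝ → ℝ) : Prop where
  zero : c 0 = 0
  continuousOn : ContinuousOn c (Set.Ici 0)
  strictMonoOn : StrictMonoOn c (Set.Ici 0)
  tendsto : Filter.Tendsto c Filter.atTop Filter.atTop

/-- The parametric type-space `c_k(x) = θ_k · c(x)`. -/
def parametric {K : ℕ} (θ : Fin K → ℝ) (c : ℝ → ℝ) : Fin K → ℝ → ℝ := fun k x => θ k * c x

/-- Number of the `N` opponents' efforts `y` that lie strictly below `x`. -/
def numBelow {N : ℕ} (x : ℝ) (y : Fin N → ℝ) : ℕ := (Finset.univ.filter fun i => y i < x).card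

/-- Number of the `N` opponents' efforts `y` that are equal to `x`. -/
def numTied {N : ℕ} (x : ℝ) (y : Fin N → ℝ) : ℕ := (Finset.univ.filter fun i => y i = x).card

/-- Prize of an agent with effort `x` when the opponents' efforts are `y`, ties being broken
uniformly at random: with `i` opponents strictly below and `j` tied, it is the average of the
`j + 1` prizes `v i, …, v (i + j)`. -/
def prize {N : ℕ} (v : Fin (N + 1) → ℝ) (x : ℝ) (y : Fin N → ℝ) : ℝ :=
  (∑ r ∈ Finset.univ.filter (fun r : Fin (N + 1) =>
      numBelow x y ≤ (r : ℕ) ∧ (r : ℕ) ≤ numBelow x y + numTied x y), v r)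
    / ((numTied x y : ℝ) + 1)

/-- Ex-ante law of the effort `X` of one agent: the type is `k` with probability `p k`, and then
the effort has law `σ k`. -/
def effortLaw {K : ℕ} (p : Fin K → ℝ) (σ : Fin K → Measure ℝ) : Measure ℝ :=
  ∑ k, ENNReal.ofReal (p k) • σ k

/-- Interim expected payoff of an agent of type `k` who exerts effort `x`, against `N` opponents
whose types are independent with law `p` and who all play the mixed strategy `σ`.
`C k` is the cost function of type `k`. -/
def payoff {N K : ℕ} (C : Fin K → ℝ → ℝ) (p : Fin K → ℝ) (v : Fin (N + 1) → ℝ)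
    (σ : Fin K → Measure ℝ) (k : Fin K) (x : ℝ) : ℝ :=
  (∫ y, prize v x y ∂(Measure.pi fun _ : Fin N => effortLaw p σ)) - C k x

/-- Symmetric Bayes–Nash equilibrium in mixed strategies: each type `k` draws its effort from a
probability measure `σ k` on `[0, ∞)`, almost all of whose efforts are best responses for type `k`
when all other agents use `σ`. -/
structure IsSymmetricEquilibrium {N K : ℕ} (C : Fin K → ℝ → ℝ) (p : Fin K → ℝ)
    (v : Fin (N + 1) → ℝ) (σ : Fin K → Measure ℝ) : Prop where
  prob : ∀ k, IsProbabilityMeasure (σ k)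
  nonneg : ∀ k, ∀ᵐ x ∂(σ k), 0 ≤ x
  best : ∀ k, ∀ᵐ x ∂(σ k), ∀ x' : ℝ, 0 ≤ x' → payoff C p v σ k x' ≤ payoff C p v σ k x

/-- The expected equilibrium effort `𝔼[X]` of the contest `v` is well defined and equal to `e`:
a symmetric equilibrium exists, and in every symmetric equilibrium the ex-ante effort of an agent
is integrable with mean `e`. -/
def HasExpectedEffort {N K : ℕ} (C : Fin K → ℝ → ℝ) (p : Fin K → ℝ)
    (v : Fin (N + 1) → ℝ) (e : ℝ) : Prop :=
  (∃ σ : Fin K → Measure ℝ, IsSymmetricEquilibrium C p v σ) ∧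
    ∀ σ : Fin K → Measure ℝ, IsSymmetricEquilibrium C p v σ →
      Integrable (fun x : ℝ => x) (effortLaw p σ) ∧ ∫ x, x ∂(effortLaw p σ) = e

end Contest

end

noncomputable section

namespace Contest

/-! Let W_v(t) = `(prizePoly v).eval t` be the expected prize of an agent who beats each opponent
with probability t. If v is not constant, an equilibrium has no atoms, since a slightly higher
effort would win all ties, and abler types exert more effort. So the effort X(t) at quantile t of
the population has rank t, and the incentive constraints within each type force c(X(t)) = G_v(t) =
∫₀ᵗ W_v'(s)/θ(s) ds (`scaledCost`), where θ(s) is the cost parameter at quantile s. This determines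
the law of effort (`effortLaw_eq`), and conversely these efforts form an equilibrium. With constant
prizes every effort is 0. In all cases E[X] = ∫₀¹ φ(G_v), where φ = c⁻¹ is convex.

Let u be winner-takes-all, R = W_u - W_v and D = G_u - G_v. The ratio W_v'(t)/tⁿ is nonincreasing (N
= n + 1), while W_u' is a multiple of tⁿ, so R' changes sign once, from - to +, at some a. As 1/θ is
nondecreasing, D(t) ≥ (R(t) - R(0))/θ(a). The integral of the right side is nonnegative by the
budget, because ∫₀¹ W_v = (∑ v_m)/(N+1). Hence ∫D ≥ 0, and D crosses zero once, from below, at some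
τ (`scaledCost_single_crossing`). With m a slope of φ at G_v(τ) > 0, convexity gives φ(G_u) - φ(G_v)
≥ m·D at every t, and integration gives the claim; if G_v(τ) = 0, then G_u ≥ G_v throughout. In the
former case strictness comes from ∫D > 0 when K ≥ 2, or from strict convexity of φ near t = 1, where
D > 0. -/

/-! ### Expected prizes as polynomials in Bernstein form. -/

open Polynomial in
/-- The expected prize, as a polynomial in the probability `t` of outperforming one opponent. -/
def prizePoly {N : ℕ} (v : Fin (N + 1) → ℝ) : ℝ[X] :=
  ∑ m : Fin (N + 1), C (v m) * bernsteinPolynomial ℝ N m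

lemma bernsteinPolynomial_eval_nonneg (n m : ℕ) {t : ℝ} (h0 : 0 ≤ t) (h1 : t ≤ 1) :
    0 ≤ (bernsteinPolynomial ℝ n m).eval t := by
  have : 0 ≤ 1 - t := by linarith
  simp only [bernsteinPolynomial, Polynomial.eval_mul, Polynomial.eval_natCast,
    Polynomial.eval_pow, Polynomial.eval_X, Polynomial.eval_sub, Polynomial.eval_one]
  positivity

lemma bernsteinPolynomial_eval_pos {n m : ℕ} (hm : m ≤ n) {t : ℝ} (h0 : 0 < t) (h1 : t < 1) :
    0 < (bernsteinPolynomial ℝ n m).eval t := by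
  have : 0 < 1 - t := by linarith
  have : 0 < n.choose m := Nat.choose_pos hm
  simp only [bernsteinPolynomial, Polynomial.eval_mul, Polynomial.eval_natCast,
    Polynomial.eval_pow, Polynomial.eval_X, Polynomial.eval_sub, Polynomial.eval_one]
  positivity

lemma prizePoly_eval_zero {N : ℕ} (v : Fin (N + 1) → ℝ) : (prizePoly v).eval 0 = v 0 := by
  simp [prizePoly, Polynomial.eval_finsetSum, bernsteinPolynomial.eval_at_0]

lemma prizePoly_eval_one {N : ℕ} (v : Fin (N + 1) → ℝ) :
    (prizePoly v).eval 1 = v (Fin.last N) := by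
  have h : ∀ m : Fin (N + 1), (m : ℕ) = N ↔ m = Fin.last N := fun m => by simp [Fin.ext_iff]
  simp [prizePoly, Polynomial.eval_finsetSum, bernsteinPolynomial.eval_at_1, h]

-- Summation by parts on the Bernstein derivative recurrence. The coefficients become prize gaps, so
-- monotonicity of `v` can be read off as nonnegativity.
open Polynomial in
lemma derivative_prizePoly {n : ℕ} (v : Fin (n + 2) → ℝ) :
    derivative (prizePoly v) = ∑ m : Fin (n + 1),
      C ((n + 1 : ℝ) * (v m.succ - v m.castSucc)) * bernsteinPolynomial ℝ n m := by
  -- The index n + 1 contributes nothing in degree n. Peeling this sum at the top (`h`) and at the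
  -- bottom (`h'`) gives the index shift.
  have h : ∑ m : Fin (n + 2), C (v m) * bernsteinPolynomial ℝ n m =
      ∑ m : Fin (n + 1), C (v m.castSucc) * bernsteinPolynomial ℝ n m := by
    rw [Fin.sum_univ_castSucc]
    simp [bernsteinPolynomial.eq_zero_of_lt]
  have h' := h
  rw [Fin.sum_univ_succ] at h'
  unfold prizePoly
  rw [derivative_sum, Fin.sum_univ_succ]
  simp only [derivative_C_mul, Fin.val_zero, Fin.val_succ, bernsteinPolynomial.derivative_succ,
    bernsteinPolynomial.derivative_zero, Nat.add_sub_cancel]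
  have e : ∑ m : Fin (n + 1), C ((n + 1 : ℝ) * (v m.succ - v m.castSucc)) *
        bernsteinPolynomial ℝ n m =
      ((n + 1 : ℕ) : ℝ[X]) * (∑ m : Fin (n + 1), C (v m.succ) * bernsteinPolynomial ℝ n m -
        ∑ m : Fin (n + 1), C (v m.castSucc) * bernsteinPolynomial ℝ n m) := by
    rw [← Finset.sum_sub_distrib, Finset.mul_sum]
    refine Finset.sum_congr rfl fun m _ => ?_
    simp only [map_mul, map_sub, map_add, map_natCast, map_one]
    push_cast
    ring
  have e2 : ∑ m : Fin (n + 1), C (v m.succ) * (((n + 1 : ℕ) : ℝ[X]) *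
        (bernsteinPolynomial ℝ n m - bernsteinPolynomial ℝ n (m + 1))) =
      ((n + 1 : ℕ) : ℝ[X]) * (∑ m : Fin (n + 1), C (v m.succ) * bernsteinPolynomial ℝ n m -
        ∑ m : Fin (n + 1), C (v m.succ) * bernsteinPolynomial ℝ n (m + 1)) := by
    rw [← Finset.sum_sub_distrib, Finset.mul_sum]
    exact Finset.sum_congr rfl fun m _ => by ring
  rw [e, e2, ← h']
  simp only [Fin.val_zero, Fin.val_succ]
  ring

lemma derivative_prizePoly_nonneg {N : ℕ} {v : Fin (N + 1) → ℝ} (hv : Monotone v) {t : ℝ}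
    (h0 : 0 ≤ t) (h1 : t ≤ 1) : 0 ≤ (Polynomial.derivative (prizePoly v)).eval t := by
  cases N with
  | zero => simp [prizePoly, bernsteinPolynomial]
  | succ n =>
    rw [derivative_prizePoly, Polynomial.eval_finsetSum]
    refine Finset.sum_nonneg fun m _ => ?_
    rw [Polynomial.eval_mul, Polynomial.eval_C]
    have := hv (Fin.castSucc_lt_succ (i := m)).le
    exact mul_nonneg (mul_nonneg (by positivity) (by linarith))
      (bernsteinPolynomial_eval_nonneg _ _ h0 h1)

lemma derivative_prizePoly_pos {N : ℕ} {v : Fin (N + 1) → ℝ} (hv : Monotone v)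
    (hlt : v 0 < v (Fin.last N)) {t : ℝ}
    (h0 : 0 < t) (h1 : t < 1) : 0 < (Polynomial.derivative (prizePoly v)).eval t := by
  cases N with
  | zero => simp at hlt
  | succ n =>
    rw [derivative_prizePoly, Polynomial.eval_finsetSum]
    have hd : ∀ m : Fin (n + 1), 0 ≤ v m.succ - v m.castSucc := fun m =>
      sub_nonneg.2 (hv (Fin.castSucc_lt_succ (i := m)).le)
    have key : ∃ m : Fin (n + 1), 0 < v m.succ - v m.castSucc := by
      by_contra! hcon
      have : ∀ m : Fin (n + 2), v m = v 0 := by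
        intro m
        induction m using Fin.induction with
        | zero => rfl
        | succ i ih => have := hcon i; have := hd i; linarith
      exact hlt.ne' (this _)
    refine Finset.sum_pos' (fun m _ => ?_) ?_
    · rw [Polynomial.eval_mul, Polynomial.eval_C]
      exact mul_nonneg (mul_nonneg (by positivity) (hd m))
        (bernsteinPolynomial_eval_nonneg _ _ h0.le h1.le)
    · obtain ⟨m, hm⟩ := key
      refine ⟨m, Finset.mem_univ _, ?_⟩
      rw [Polynomial.eval_mul, Polynomial.eval_C]
      exact mul_pos (mul_pos (by positivity) hm)
        (bernsteinPolynomial_eval_pos (by omega) h0 h1)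

lemma monotoneOn_prizePoly {N : ℕ} {v : Fin (N + 1) → ℝ} (hv : Monotone v) :
    MonotoneOn (fun t => (prizePoly v).eval t) (Set.Icc 0 1) := by
  refine monotoneOn_of_deriv_nonneg (convex_Icc 0 1) (prizePoly v).continuous.continuousOn
    (prizePoly v).differentiable.differentiableOn fun x hx => ?_
  rw [interior_Icc] at hx
  rw [Polynomial.deriv]
  exact derivative_prizePoly_nonneg hv hx.1.le hx.2.le

lemma strictMonoOn_prizePoly {N : ℕ} {v : Fin (N + 1) → ℝ} (hv : Monotone v)
    (hlt : v 0 < v (Fin.last N)) :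
    StrictMonoOn (fun t => (prizePoly v).eval t) (Set.Icc 0 1) := by
  refine strictMonoOn_of_deriv_pos (convex_Icc 0 1) (prizePoly v).continuous.continuousOn
    fun x hx => ?_
  rw [interior_Icc] at hx
  rw [Polynomial.deriv]
  exact derivative_prizePoly_pos hv hlt hx.1 hx.2

lemma integral_derivative_eval (P : Polynomial ℝ) (a b : ℝ) :
    ∫ s in a..b, (Polynomial.derivative P).eval s = P.eval b - P.eval a := by
  refine intervalIntegral.integral_eq_sub_of_hasDerivAt (fun x _ => P.hasDerivAt x) ?_
  exact (Polynomial.derivative P).continuous.intervalIntegrable _ _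

/-- The Bernstein polynomial of degree n + 1 and index m + 1 ≤ n vanishes at 0 and 1, and its
derivative is (n + 1) times the difference of two consecutive polynomials of degree n. So
consecutive integrals agree, and index 0 gives the common value. -/
lemma integral_bernsteinPolynomial {n m : ℕ} (hm : m ≤ n) :
    ∫ t in (0 : ℝ)..1, (bernsteinPolynomial ℝ n m).eval t = 1 / (n + 1) := by
  have hint : ∀ k, IntervalIntegrable (fun t => (bernsteinPolynomial ℝ n k).eval t) volume 0 1 :=
    fun k => (bernsteinPolynomial ℝ n k).continuous.intervalIntegrable _ _
  induction m with
  | zero =>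
    have h := integral_derivative_eval (bernsteinPolynomial ℝ (n + 1) 0) 0 1
    rw [bernsteinPolynomial.derivative_zero, bernsteinPolynomial.eval_at_0,
      bernsteinPolynomial.eval_at_1] at h
    simp only [Nat.add_sub_cancel, Polynomial.eval_mul, Polynomial.eval_neg,
      Polynomial.eval_natCast, intervalIntegral.integral_const_mul] at h
    have hn : (n : ℝ) + 1 ≠ 0 := by positivity
    field_simp
    push_cast at h
    simp at h
    linarith
  | succ m ih =>
    have h := integral_derivative_eval (bernsteinPolynomial ℝ (n + 1) (m + 1)) 0 1
    rw [bernsteinPolynomial.derivative_succ, bernsteinPolynomial.eval_at_0,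
      bernsteinPolynomial.eval_at_1, if_neg (by omega), if_neg (by omega)] at h
    simp only [Nat.add_sub_cancel, Polynomial.eval_mul, Polynomial.eval_sub,
      Polynomial.eval_natCast, intervalIntegral.integral_const_mul] at h
    rw [intervalIntegral.integral_sub (hint _) (hint _), ih (by omega)] at h
    have hn : ((n + 1 : ℕ) : ℝ) ≠ 0 := by positivity
    simp only [sub_zero, mul_eq_zero, hn, false_or] at h
    linarith

/-- This is how the budget enters the comparison of contests. -/
lemma integral_prizePoly {N : ℕ} (v : Fin (N + 1) → ℝ) :
    ∫ t in (0 : ℝ)..1, (prizePoly v).eval t = (∑ m, v m) / (N + 1) := by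
  simp only [prizePoly, Polynomial.eval_finsetSum, Polynomial.eval_mul, Polynomial.eval_C]
  rw [intervalIntegral.integral_finsetSum]
  · rw [Finset.sum_div]
    refine Finset.sum_congr rfl fun m _ => ?_
    rw [intervalIntegral.integral_const_mul, integral_bernsteinPolynomial (by omega)]
    ring
  · intro m _
    exact ((bernsteinPolynomial ℝ N m).continuous.const_mul _).intervalIntegrable _ _

lemma derivative_prizePoly_winnerTakesAll (n : ℕ) (V t : ℝ) :
    (Polynomial.derivative (prizePoly (winnerTakesAll (n + 1) V))).eval t =
      (n + 1) * V * t ^ n := by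
  rw [derivative_prizePoly, Polynomial.eval_finsetSum, Fin.sum_univ_castSucc,
    Finset.sum_eq_zero]
  · have : winnerTakesAll (n + 1) V (Fin.last n).castSucc = 0 := by
      simp [winnerTakesAll, Fin.ext_iff]
    rw [this]
    simp [winnerTakesAll, bernsteinPolynomial]
  · intro m _
    have h1 : winnerTakesAll (n + 1) V m.castSucc.castSucc = 0 :=
      Pi.single_eq_of_ne (by have := m.2; rw [Ne, Fin.ext_iff]; simp; omega) _
    have h2 : winnerTakesAll (n + 1) V m.castSucc.succ = 0 :=
      Pi.single_eq_of_ne (by have := m.2; rw [Ne, Fin.ext_iff]; simp; omega) _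
    rw [h1, h2]
    simp

/-- Once the marginal prize of winner-takes-all exceeds that of another contest, it stays
above it. -/
lemma marginal_single_crossing {n : ℕ} {v : Fin (n + 2) → ℝ} (hv : Monotone v) {V s t : ℝ}
    (hs : 0 < s) (hst : s ≤ t) (ht : t ≤ 1)
    (h : (Polynomial.derivative (prizePoly v)).eval s ≤
      (Polynomial.derivative (prizePoly (winnerTakesAll (n + 1) V))).eval s) :
    (Polynomial.derivative (prizePoly v)).eval t ≤
      (Polynomial.derivative (prizePoly (winnerTakesAll (n + 1) V))).eval t := by
  rw [derivative_prizePoly_winnerTakesAll] at h ⊢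
  have hsn : 0 < s ^ n := by positivity
  have htn : 0 ≤ t ^ n := pow_nonneg (hs.le.trans hst) n
  -- Divided by tⁿ, the Bernstein term of index m is a multiple of ((1 - t)/t)^(n - m), which is
  -- nonincreasing in t. The inequality is the cross-multiplied form.
  have key : s ^ n * (Polynomial.derivative (prizePoly v)).eval t ≤
      t ^ n * (Polynomial.derivative (prizePoly v)).eval s := by
    rw [derivative_prizePoly, Polynomial.eval_finsetSum, Polynomial.eval_finsetSum,
      Finset.mul_sum, Finset.mul_sum]
    refine Finset.sum_le_sum fun m _ => ?_
    have hm : (m : ℕ) ≤ n := by omega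
    have hd := hv (Fin.castSucc_lt_succ (i := m)).le
    simp only [bernsteinPolynomial, Polynomial.eval_mul, Polynomial.eval_natCast,
      Polynomial.eval_pow, Polynomial.eval_X, Polynomial.eval_sub, Polynomial.eval_one,
      Polynomial.eval_C]
    have e : ∀ a : ℝ, a ^ n = a ^ (m : ℕ) * a ^ (n - m) := fun a => by
      rw [← pow_add, Nat.add_sub_cancel' hm]
    have h1 : (s * (1 - t)) ^ (n - (m : ℕ)) ≤ (t * (1 - s)) ^ (n - (m : ℕ)) :=
      pow_le_pow_left₀ (mul_nonneg hs.le (by linarith)) (by nlinarith) _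
    have h2 : 0 ≤ (n + 1 : ℝ) * (v m.succ - v m.castSucc) * (n.choose m) *
        (s ^ (m : ℕ) * t ^ (m : ℕ)) := by
      have : 0 ≤ v m.succ - v m.castSucc := by linarith
      have : 0 ≤ t := hs.le.trans hst
      positivity
    have h3 := mul_le_mul_of_nonneg_left h1 h2
    rw [mul_pow, mul_pow] at h3
    rw [e s, e t]
    linarith
  have : s ^ n * (Polynomial.derivative (prizePoly v)).eval t ≤
      s ^ n * ((n + 1) * V * t ^ n) := by
    refine key.trans ?_
    calc t ^ n * (Polynomial.derivative (prizePoly v)).eval s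
        ≤ t ^ n * ((n + 1) * V * s ^ n) := mul_le_mul_of_nonneg_left h htn
      _ = _ := by ring
  exact le_of_mul_le_mul_left this hsn

/-- A continuous function on `[0, 1]` that stays nonnegative once it is nonnegative, and ends
nonnegative, changes its sign at one point. -/
lemma exists_sign_change {q : ℝ → ℝ} (hq : Continuous q) (h1 : 0 ≤ q 1)
    (hup : ∀ s t, 0 < s → s ≤ t → t ≤ 1 → 0 ≤ q s → 0 ≤ q t) :
    ∃ a ∈ Set.Icc (0 : ℝ) 1, (∀ s ∈ Set.Ico 0 a, q s ≤ 0) ∧ ∀ s ∈ Set.Icc a 1, 0 ≤ q s := by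
  -- The point 0 is left out because `hup` starts from s > 0 only. The signs at 0 and at the infimum
  -- are recovered by taking closures.
  set S : Set ℝ := {s | 0 < s ∧ s ≤ 1 ∧ 0 ≤ q s} with hS
  have h1S : (1 : ℝ) ∈ S := ⟨one_pos, le_rfl, h1⟩
  have hbdd : BddBelow S := ⟨0, fun s hs => hs.1.le⟩
  have ha0 : 0 ≤ sInf S := le_csInf ⟨1, h1S⟩ fun s hs => hs.1.le
  have ha1 : sInf S ≤ 1 := csInf_le hbdd h1S
  have habove : ∀ s, sInf S < s → s ≤ 1 → 0 ≤ q s := by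
    intro s hs hs1
    obtain ⟨r, hr, hrs⟩ := exists_lt_of_csInf_lt ⟨1, h1S⟩ hs
    exact hup r s hr.1 hrs.le hs1 hr.2.2
  have hbelow : ∀ s, 0 < s → s < sInf S → q s ≤ 0 := by
    intro s hs0 hs
    by_contra! hcon
    exact absurd (csInf_le hbdd ⟨hs0, hs.le.trans ha1, hcon.le⟩) (not_le.2 hs)
  refine ⟨sInf S, ⟨ha0, ha1⟩, ?_, ?_⟩
  · rcases ha0.eq_or_lt with h0 | h0
    · intro s hs
      exact absurd (hs.1.trans_lt hs.2) (by rw [← h0]; exact lt_irrefl _)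
    · have hcl : IsClosed {s | q s ≤ 0} := isClosed_le hq continuous_const
      have hsub : Set.Ioo 0 (sInf S) ⊆ {s | q s ≤ 0} := fun s hs => hbelow s hs.1 hs.2
      have := closure_minimal hsub hcl
      rw [closure_Ioo h0.ne] at this
      exact fun s hs => this ⟨hs.1, hs.2.le⟩
  · rcases ha1.eq_or_lt with h0 | h0
    · intro s hs
      have : s = 1 := le_antisymm hs.2 (h0 ▸ hs.1)
      rwa [this]
    · have hcl : IsClosed {s | 0 ≤ q s} := isClosed_le continuous_const hq
      have hsub : Set.Ioo (sInf S) 1 ⊆ {s | 0 ≤ q s} := fun s hs => habove s hs.1 hs.2.le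
      have := closure_minimal hsub hcl
      rw [closure_Ioo h0.ne] at this
      exact this

/-! ### Ties and the binomial number of beaten opponents. -/

/-- The prize for outperforming `m` opponents, as a function on all of `ℕ`. -/
def prizeAt {N : ℕ} (v : Fin (N + 1) → ℝ) (m : ℕ) : ℝ := v ⟨min m N, by omega⟩

lemma prizeAt_mono {N : ℕ} {v : Fin (N + 1) → ℝ} (hv : Monotone v) : Monotone (prizeAt v) :=
  fun a b h => hv (by simp only [Fin.mk_le_mk]; omega)

lemma prizeAt_val {N : ℕ} (v : Fin (N + 1) → ℝ) (r : Fin (N + 1)) : prizeAt v r = v r := by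
  unfold prizeAt
  congr 1
  ext
  simp; omega

/-- Number of coordinates of `y` that lie in `B`. -/
def countIn {N : ℕ} (B : Set ℝ) (y : Fin N → ℝ) : ℕ :=
  by classical exact (Finset.univ.filter fun i => y i ∈ B).card

lemma countIn_le {N : ℕ} (B : Set ℝ) (y : Fin N → ℝ) : countIn B y ≤ N := by
  classical
  exact (Finset.card_le_univ _).trans (by simp)

lemma measurable_countIn {N : ℕ} {B : Set ℝ} (hB : MeasurableSet B) :
    Measurable (countIn B : (Fin N → ℝ) → ℕ) := by
  classical
  have : (countIn B : (Fin N → ℝ) → ℕ) =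
      fun y => ∑ i, (Set.indicator B (fun _ => 1) (y i) : ℕ) := by
    ext y
    simp [countIn, Set.indicator_apply, Finset.sum_boole]
  rw [this]
  exact Finset.measurable_sum _ fun i _ =>
    (measurable_const.indicator hB).comp (measurable_pi_apply i)

lemma numBelow_eq {N : ℕ} (x : ℝ) (y : Fin N → ℝ) : numBelow x y = countIn (Set.Iio x) y := by
  simp [numBelow, countIn]

lemma numTied_eq {N : ℕ} (x : ℝ) (y : Fin N → ℝ) : numTied x y = countIn {x} y := by
  simp [numTied, countIn]

lemma numBelow_add_numTied {N : ℕ} (x : ℝ) (y : Fin N → ℝ) :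
    numBelow x y + numTied x y = countIn (Set.Iic x) y := by
  classical
  unfold numBelow numTied countIn
  rw [← Finset.card_union_of_disjoint]
  · congr 1
    ext i
    simp [le_iff_lt_or_eq]
  · rw [Finset.disjoint_filter]
    intro i _ h1 h2
    exact h1.ne h2

lemma numBelow_add_numTied_le {N : ℕ} (x : ℝ) (y : Fin N → ℝ) :
    numBelow x y + numTied x y ≤ N := numBelow_add_numTied x y ▸ countIn_le _ _

lemma card_filter_window {N a b : ℕ} (h : a + b ≤ N) :
    (Finset.univ.filter fun r : Fin (N + 1) => a ≤ (r : ℕ) ∧ (r : ℕ) ≤ a + b).card = b + 1 := by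
  have : (Finset.univ.filter fun r : Fin (N + 1) => a ≤ (r : ℕ) ∧ (r : ℕ) ≤ a + b) =
      Finset.Icc ⟨a, by omega⟩ ⟨a + b, by omega⟩ := by
    ext r
    simp [Fin.le_def]
  rw [this, Fin.card_Icc]
  simp; omega

/-- Together with `prize_le_prizeAt`, this places the tie-breaking average between losing all ties
and winning all ties. In expectation the two bounds coincide when there is no atom. -/
lemma prizeAt_numBelow_le_prize {N : ℕ} {v : Fin (N + 1) → ℝ} (hv : Monotone v) (x : ℝ)
    (y : Fin N → ℝ) : prizeAt v (numBelow x y) ≤ prize v x y := by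
  unfold prize
  rw [le_div_iff₀ (by positivity)]
  have hc := card_filter_window (numBelow_add_numTied_le x y)
  have := Finset.card_nsmul_le_sum (Finset.univ.filter fun r : Fin (N + 1) =>
      numBelow x y ≤ (r : ℕ) ∧ (r : ℕ) ≤ numBelow x y + numTied x y) v (prizeAt v (numBelow x y))
    (fun r hr => by
      rw [← prizeAt_val v r]
      exact prizeAt_mono hv (Finset.mem_filter.1 hr).2.1)
  rw [hc, nsmul_eq_mul] at this
  push_cast at this
  linarith

lemma prize_le_prizeAt {N : ℕ} {v : Fin (N + 1) → ℝ} (hv : Monotone v) (x : ℝ)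
    (y : Fin N → ℝ) : prize v x y ≤ prizeAt v (countIn (Set.Iic x) y) := by
  rw [← numBelow_add_numTied]
  unfold prize
  rw [div_le_iff₀ (by positivity)]
  have hc := card_filter_window (numBelow_add_numTied_le x y)
  have := Finset.sum_le_card_nsmul (Finset.univ.filter fun r : Fin (N + 1) =>
      numBelow x y ≤ (r : ℕ) ∧ (r : ℕ) ≤ numBelow x y + numTied x y) v
      (prizeAt v (numBelow x y + numTied x y))
    (fun r hr => by
      rw [← prizeAt_val v r]
      exact prizeAt_mono hv (Finset.mem_filter.1 hr).2.2)
  rw [hc, nsmul_eq_mul] at this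
  push_cast at this
  linarith

/-- A tie of all N + 1 agents pays the mean prize, which is below the top prize. At an atom this
event has positive probability. -/
lemma prize_const_lt {N : ℕ} {v : Fin (N + 1) → ℝ} (hv : Monotone v)
    (hlt : v 0 < v (Fin.last N)) (x : ℝ) :
    prize v x (fun _ => x) < prizeAt v (countIn (Set.Iic x) (fun _ : Fin N => x)) := by
  have h1 : numBelow x (fun _ : Fin N => x) = 0 := by simp [numBelow]
  have h2 : numTied x (fun _ : Fin N => x) = N := by simp [numTied]
  have h3 : countIn (Set.Iic x) (fun _ : Fin N => x) = N := by simp [countIn]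
  have h4 : ∀ r : Fin (N + 1), (r : ℕ) ≤ N := fun r => by omega
  have h5 : prizeAt v N = v (Fin.last N) := prizeAt_val v (Fin.last N)
  unfold prize
  rw [h3, h1, h2, h5, div_lt_iff₀ (by positivity)]
  simp only [zero_le, zero_add, true_and, h4, Finset.filter_true]
  calc ∑ r, v r < ∑ _r : Fin (N + 1), v (Fin.last N) :=
        Finset.sum_lt_sum (fun r _ => hv (Fin.le_last r)) ⟨0, Finset.mem_univ _, hlt⟩
    _ = _ := by simp; ring

lemma measurable_prize {N : ℕ} (v : Fin (N + 1) → ℝ) (x : ℝ) : Measurable (prize v x) := by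
  have : prize v x = (fun ab : ℕ × ℕ => (∑ r ∈ Finset.univ.filter (fun r : Fin (N + 1) =>
      ab.1 ≤ (r : ℕ) ∧ (r : ℕ) ≤ ab.1 + ab.2), v r) / ((ab.2 : ℝ) + 1)) ∘
      fun y => (countIn (Set.Iio x) y, countIn {x} y) := by
    ext y
    simp only [prize, Function.comp, numBelow_eq, numTied_eq]
  rw [this]
  exact (Measurable.of_discrete).comp
    ((measurable_countIn measurableSet_Iio).prodMk (measurable_countIn (measurableSet_singleton x)))

lemma prizeAt_mem {N : ℕ} {v : Fin (N + 1) → ℝ} (hv : Monotone v) (m : ℕ) :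
    prizeAt v m ∈ Set.Icc (v 0) (v (Fin.last N)) :=
  ⟨hv (Fin.zero_le _), hv (Fin.le_last _)⟩

lemma integrable_prize {N : ℕ} {v : Fin (N + 1) → ℝ} (hv : Monotone v) (x : ℝ)
    (ρ : Measure (Fin N → ℝ)) [IsFiniteMeasure ρ] : Integrable (prize v x) ρ := by
  refine Integrable.of_mem_Icc (v 0) (v (Fin.last N)) (measurable_prize v x).aemeasurable ?_
  exact .of_forall fun y => ⟨(prizeAt_mem hv _).1.trans (prizeAt_numBelow_le_prize hv x y),
    (prize_le_prizeAt hv x y).trans (prizeAt_mem hv _).2⟩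

lemma integrable_prizeAt {N : ℕ} {v : Fin (N + 1) → ℝ} (hv : Monotone v) {B : Set ℝ}
    (hB : MeasurableSet B) (ρ : Measure (Fin N → ℝ)) [IsFiniteMeasure ρ] :
    Integrable (fun y => prizeAt v (countIn B y)) ρ := by
  refine Integrable.of_mem_Icc (v 0) (v (Fin.last N))
    ((Measurable.of_discrete (f := prizeAt v)).comp (measurable_countIn hB)).aemeasurable ?_
  exact .of_forall fun y => prizeAt_mem hv _

/-- The number of opponents whose effort lies in `B` is binomial. -/
lemma integral_prizeAt_countIn {N : ℕ} (v : Fin (N + 1) → ℝ) {B : Set ℝ} (hB : MeasurableSet B)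
    (μ : Measure ℝ) [IsProbabilityMeasure μ] :
    ∫ y, prizeAt v (countIn B y) ∂(Measure.pi fun _ : Fin N => μ) =
      (prizePoly v).eval (μ.real B) := by
  classical
  set ρ := Measure.pi fun _ : Fin N => μ
  -- The sets `T S` partition the space according to which opponents fall in `B`. Independence gives
  -- each of them its binomial weight.
  let T : Finset (Fin N) → Set (Fin N → ℝ) := fun S =>
    Set.pi Set.univ fun i => if i ∈ S then B else Bᶜ
  have hT : ∀ S, MeasurableSet (T S) := fun S => MeasurableSet.univ_pi fun i => by
    split_ifs
    exacts [hB, hB.compl]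
  have hmem : ∀ S y, y ∈ T S ↔ Finset.univ.filter (fun i => y i ∈ B) = S := by
    intro S y
    simp only [T, Set.mem_univ_pi, Finset.ext_iff, Finset.mem_filter, Finset.mem_univ, true_and]
    refine forall_congr' fun i => ?_
    by_cases h : i ∈ S <;> simp [h]
  have hf : (fun y : Fin N → ℝ => prizeAt v (countIn B y)) =
      fun y => ∑ S : Finset (Fin N), (T S).indicator (fun _ => prizeAt v S.card) y := by
    ext y
    simp only [Set.indicator_apply, hmem, Finset.sum_ite_eq, Finset.mem_univ, if_true]
    rfl
  have hreal : ∀ S, ρ.real (T S) = μ.real B ^ S.card * (1 - μ.real B) ^ (N - S.card) := by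
    intro S
    have : ρ (T S) = ∏ i, μ (if i ∈ S then B else Bᶜ) := Measure.pi_pi _ _
    rw [measureReal_def, this, ENNReal.toReal_prod]
    have h2 : ∀ i, (μ (if i ∈ S then B else Bᶜ)).toReal =
        if i ∈ S then μ.real B else 1 - μ.real B := by
      intro i
      split_ifs
      · rfl
      · exact probReal_compl_eq_one_sub hB
    simp_rw [h2]
    rw [Finset.prod_ite, Finset.prod_const, Finset.prod_const]
    congr 2
    · simp
    · rw [Finset.filter_not, ← Finset.compl_eq_univ_sdiff, Finset.card_compl]; simp
  rw [hf, integral_finsetSum]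
  · simp_rw [integral_indicator_const _ (hT _), hreal, smul_eq_mul]
    rw [← Finset.powerset_univ, Finset.sum_powerset_apply_card
      (fun m => μ.real B ^ m * (1 - μ.real B) ^ (N - m) * prizeAt v m)]
    simp only [Finset.card_univ, Fintype.card_fin, prizePoly, Polynomial.eval_finsetSum,
      Finset.sum_range, Polynomial.eval_mul, Polynomial.eval_C, prizeAt_val, nsmul_eq_mul]
    refine Finset.sum_congr rfl fun m _ => ?_
    simp only [bernsteinPolynomial, Polynomial.eval_mul, Polynomial.eval_natCast,
      Polynomial.eval_pow, Polynomial.eval_X, Polynomial.eval_sub, Polynomial.eval_one]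
    ring
  · intro S _
    exact (integrable_const _).indicator (hT S)

lemma measureReal_Iio_eq_Iic {μ : Measure ℝ} {x : ℝ} (hx : μ {x} = 0) :
    μ.real (Set.Iio x) = μ.real (Set.Iic x) := by
  rw [← Set.Iio_union_right, measureReal_def, measureReal_def]
  congr 1
  exact le_antisymm (measure_mono Set.subset_union_left)
    ((measure_union_le _ _).trans (by rw [hx, add_zero]))

/-- Expected prize from effort `x` when each opponent's effort has law `μ`. -/
def expectedPrize {N : ℕ} (v : Fin (N + 1) → ℝ) (μ : Measure ℝ) (x : ℝ) : ℝ :=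
  ∫ y, prize v x y ∂(Measure.pi fun _ : Fin N => μ)

lemma le_expectedPrize {N : ℕ} {v : Fin (N + 1) → ℝ} (hv : Monotone v) (μ : Measure ℝ)
    [IsProbabilityMeasure μ] (x : ℝ) :
    (prizePoly v).eval (μ.real (Set.Iio x)) ≤ expectedPrize v μ x := by
  rw [← integral_prizeAt_countIn v measurableSet_Iio μ]
  refine integral_mono (integrable_prizeAt hv measurableSet_Iio _) (integrable_prize hv x _)
    fun y => ?_
  have := prizeAt_numBelow_le_prize hv x y
  rwa [numBelow_eq] at this

lemma expectedPrize_le {N : ℕ} {v : Fin (N + 1) → ℝ} (hv : Monotone v) (μ : Measure ℝ)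
    [IsProbabilityMeasure μ] (x : ℝ) :
    expectedPrize v μ x ≤ (prizePoly v).eval (μ.real (Set.Iic x)) := by
  rw [← integral_prizeAt_countIn v measurableSet_Iic μ]
  exact integral_mono (integrable_prize hv x _) (integrable_prizeAt hv measurableSet_Iic _)
    fun y => prize_le_prizeAt hv x y

/-- Any effort above `x` beats everyone tied at `x`. This is the deviation that rules out atoms. -/
lemma eval_Iic_le_expectedPrize {N : ℕ} {v : Fin (N + 1) → ℝ} (hv : Monotone v) (μ : Measure ℝ)
    [IsProbabilityMeasure μ] {x x' : ℝ} (h : x < x') :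
    (prizePoly v).eval (μ.real (Set.Iic x)) ≤ expectedPrize v μ x' := by
  refine le_trans ?_ (le_expectedPrize hv μ x')
  exact monotoneOn_prizePoly hv ⟨measureReal_nonneg, measureReal_le_one⟩
    ⟨measureReal_nonneg, measureReal_le_one⟩
    (measureReal_mono fun y hy => lt_of_le_of_lt hy h)

lemma expectedPrize_lt_of_atom {N : ℕ} {v : Fin (N + 1) → ℝ} (hv : Monotone v) (μ : Measure ℝ)
    [IsProbabilityMeasure μ]
    (hlt : v 0 < v (Fin.last N)) {x : ℝ} (hx : μ {x} ≠ 0) :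
    expectedPrize v μ x < (prizePoly v).eval (μ.real (Set.Iic x)) := by
  rw [← integral_prizeAt_countIn v measurableSet_Iic μ]
  have hi := integrable_prizeAt hv (measurableSet_Iic (a := x)) (Measure.pi fun _ : Fin N => μ)
  have hi' := integrable_prize hv x (Measure.pi fun _ : Fin N => μ)
  rw [← sub_pos, expectedPrize, ← integral_sub hi hi',
    integral_pos_iff_support_of_nonneg (fun y => sub_nonneg.2 (prize_le_prizeAt hv x y))
      (hi.sub hi')]
  refine lt_of_lt_of_le (b := (Measure.pi fun _ : Fin N => μ) {fun _ => x}) ?_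
    (measure_mono ?_)
  · rw [Measure.pi_singleton]
    simpa [pos_iff_ne_zero] using fun h => absurd h hx
  · rintro y rfl
    exact (sub_pos.2 (prize_const_lt hv hlt x)).ne'

lemma expectedPrize_eq {N : ℕ} {v : Fin (N + 1) → ℝ} (hv : Monotone v) (μ : Measure ℝ)
    [IsProbabilityMeasure μ] {x : ℝ} (hx : μ {x} = 0) :
    expectedPrize v μ x = (prizePoly v).eval (μ.real (Set.Iic x)) := by
  refine le_antisymm (expectedPrize_le hv μ x) ?_
  rw [← measureReal_Iio_eq_Iic hx]
  exact le_expectedPrize hv μ x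

/-! ### Quantiles of the type distribution. -/

/-- Probability of a type below `k`. -/
def lowerMass {K : ℕ} (p : Fin K → ℝ) (k : Fin K) : ℝ := ∑ j ∈ Finset.Iio k, p j

/-- The type at quantile `t` of the population, ordered from the least to the most able. -/
def typeAt {K : ℕ} [NeZero K] (p : Fin K → ℝ) (t : ℝ) : Fin K := sSup {k | lowerMass p k ≤ t}

lemma typeAt_mono {K : ℕ} [NeZero K] (p : Fin K → ℝ) : Monotone (typeAt p) :=
  fun _ _ h => sSup_le_sSup fun _ hk => le_trans hk h

section types
variable {K : ℕ} {p : Fin K → ℝ}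

lemma lowerMass_add_le (hp : ∀ k, 0 < p k) {j k : Fin K} (h : j < k) :
    lowerMass p j + p j ≤ lowerMass p k := by
  unfold lowerMass
  rw [add_comm, ← Finset.sum_insert (by simp)]
  refine Finset.sum_le_sum_of_subset_of_nonneg (fun i hi => ?_) fun i _ _ => (hp i).le
  rcases Finset.mem_insert.1 hi with rfl | hi
  · simpa using h
  · simpa using (Finset.mem_Iio.1 hi).trans h

lemma lowerMass_add_eq_sum_Iic (p : Fin K → ℝ) (k : Fin K) :
    lowerMass p k + p k = ∑ j ∈ Finset.Iic k, p j := by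
  unfold lowerMass
  rw [add_comm, ← Finset.sum_insert (by simp), Finset.Iio_insert]

lemma lowerMass_nonneg (hp : ∀ k, 0 < p k) (k : Fin K) : 0 ≤ lowerMass p k :=
  Finset.sum_nonneg fun i _ => (hp i).le

lemma lowerMass_add_le_one (hp : ∀ k, 0 < p k) (hp1 : ∑ k, p k = 1) (k : Fin K) :
    lowerMass p k + p k ≤ 1 := by
  rw [lowerMass_add_eq_sum_Iic, ← hp1]
  exact Finset.sum_le_sum_of_subset_of_nonneg (Finset.subset_univ _) fun i _ _ => (hp i).le

variable [NeZero K]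

lemma lowerMass_typeAt_le {t : ℝ} (ht : 0 ≤ t) : lowerMass p (typeAt p t) ≤ t := by
  have hne : ({k | lowerMass p k ≤ t} : Set (Fin K)).Nonempty := by
    refine ⟨0, ?_⟩
    have : (Finset.Iio (0 : Fin K)) = ∅ := by ext j; simp
    simpa [lowerMass, this] using ht
  exact hne.csSup_mem (Set.toFinite _)

lemma lt_lowerMass_typeAt_add (hp1 : ∑ k, p k = 1) {t : ℝ} (ht : t < 1) :
    t < lowerMass p (typeAt p t) + p (typeAt p t) := by
  by_contra! hcon
  rw [lowerMass_add_eq_sum_Iic] at hcon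
  by_cases hlast : ∃ k, typeAt p t < k
  · obtain ⟨k, hk⟩ := hlast
    have hk' : (typeAt p t : ℕ) < (k : ℕ) := hk
    have hlt : (typeAt p t : ℕ) + 1 < K := by have := k.2; omega
    set k' : Fin K := ⟨typeAt p t + 1, hlt⟩
    have : lowerMass p k' ≤ t := by
      refine le_trans (le_of_eq ?_) hcon
      unfold lowerMass
      congr 1
      ext j
      simp only [Finset.mem_Iio, Finset.mem_Iic, Fin.lt_def, Fin.le_def, k']
      omega
    have h2 : k' ≤ typeAt p t := le_sSup this
    have : (typeAt p t : ℕ) + 1 ≤ typeAt p t := h2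
    omega
  · push Not at hlast
    have : Finset.Iic (typeAt p t) = Finset.univ := by ext j; simp [hlast j]
    rw [this, hp1] at hcon
    linarith

lemma typeAt_eq (hp : ∀ k, 0 < p k) (hp1 : ∑ k, p k = 1) {t : ℝ} {k : Fin K}
    (h0 : lowerMass p k ≤ t) (h1 : t < lowerMass p k + p k) : typeAt p t = k := by
  have ht0 : 0 ≤ t := (lowerMass_nonneg hp k).trans h0
  have ht1 : t < 1 := h1.trans_le (lowerMass_add_le_one hp hp1 k)
  rcases lt_trichotomy (typeAt p t) k with h | h | h
  · have := lowerMass_add_le hp h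
    have := lt_lowerMass_typeAt_add (p := p) hp1 ht1
    linarith
  · exact h
  · have := lowerMass_add_le hp h
    have := lowerMass_typeAt_le (p := p) ht0
    linarith

end types

/-! ### Equilibrium cost by quantile and its incentive constraints. -/

/-- Reciprocal marginal cost of the type at quantile `t`. -/
def ability {K : ℕ} [NeZero K] (p θ : Fin K → ℝ) (t : ℝ) : ℝ := (θ (typeAt p t))⁻¹

lemma ability_pos {K : ℕ} [NeZero K] {θ : Fin K → ℝ} (p : Fin K → ℝ) (hθ : ∀ k, 0 < θ k) (t : ℝ) :
    0 < ability p θ t := inv_pos.2 (hθ _)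

lemma ability_mono {K : ℕ} [NeZero K] {θ : Fin K → ℝ} (p : Fin K → ℝ) (hθ : StrictAnti θ)
    (hpos : ∀ k, 0 < θ k) : Monotone (ability p θ) := fun _ _ h =>
  inv_anti₀ (hpos _) (hθ.antitone (typeAt_mono p h))

/-- The function `c` of the equilibrium effort at quantile `t`. -/
def scaledCost {N K : ℕ} [NeZero K] (p θ : Fin K → ℝ) (v : Fin (N + 1) → ℝ) (t : ℝ) : ℝ :=
  ∫ s in (0 : ℝ)..t, ability p θ s * (Polynomial.derivative (prizePoly v)).eval s

section scaledCost
variable {N K : ℕ} [NeZero K] {p θ : Fin K → ℝ} {v : Fin (N + 1) → ℝ}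

lemma intervalIntegrable_ability_mul (hθ : StrictAnti θ) (hpos : ∀ k, 0 < θ k) {f : ℝ → ℝ}
    (hf : Continuous f) (a b : ℝ) :
    IntervalIntegrable (fun s => ability p θ s * f s) volume a b :=
  ((ability_mono p hθ hpos).intervalIntegrable).mul_continuousOn hf.continuousOn

lemma scaledCost_sub (hθ : StrictAnti θ) (hpos : ∀ k, 0 < θ k) (s t : ℝ) :
    scaledCost p θ v t - scaledCost p θ v s =
      ∫ r in s..t, ability p θ r * (Polynomial.derivative (prizePoly v)).eval r := by
  have h := fun a b => intervalIntegrable_ability_mul (p := p) hθ hpos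
    (Polynomial.derivative (prizePoly v)).continuous a b
  exact intervalIntegral.integral_interval_sub_left (h _ _) (h _ _)

lemma scaledCost_zero : scaledCost p θ v 0 = 0 := intervalIntegral.integral_same

lemma continuous_scaledCost (hθ : StrictAnti θ) (hpos : ∀ k, 0 < θ k) :
    Continuous (scaledCost p θ v) :=
  intervalIntegral.continuous_primitive (fun a b => intervalIntegrable_ability_mul hθ hpos
    (Polynomial.derivative (prizePoly v)).continuous a b) 0

end scaledCost

/-- `g` grows at a rate between the values of the weight `w`, relative to `W`. -/
def RateBetween (w W g : ℝ → ℝ) (S : Set ℝ) : Prop :=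
  ∀ s ∈ S, ∀ t ∈ S, s ≤ t → w s * (W t - W s) ≤ g t - g s ∧ g t - g s ≤ w t * (W t - W s)

/-- On `[s, t]` the monotone weight lies between its endpoint values, and the marginal prize is
nonnegative. The two inequalities say that the types at quantiles `s` and `t` do not envy each
other, so the costs in any equilibrium satisfy them as well. -/
lemma scaledCost_rateBetween {N K : ℕ} [NeZero K] (p : Fin K → ℝ) {θ : Fin K → ℝ}
    {v : Fin (N + 1) → ℝ} (hv : Monotone v)
    (hθ : StrictAnti θ) (hpos : ∀ k, 0 < θ k) :
    RateBetween (ability p θ) (fun t => (prizePoly v).eval t) (scaledCost p θ v)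
      (Set.Icc 0 1) := by
  intro s hs t ht hst
  have hint := fun a b => intervalIntegrable_ability_mul (p := p) hθ hpos
    (Polynomial.derivative (prizePoly v)).continuous a b
  have hc : ∀ a : ℝ, IntervalIntegrable
      (fun r => a * (Polynomial.derivative (prizePoly v)).eval r) volume s t := fun a =>
    ((Polynomial.derivative (prizePoly v)).continuous.const_mul a).intervalIntegrable _ _
  have hnn : ∀ r ∈ Set.Icc s t, 0 ≤ (Polynomial.derivative (prizePoly v)).eval r := fun r hr =>
    derivative_prizePoly_nonneg hv (hs.1.trans hr.1) (hr.2.trans ht.2)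
  rw [scaledCost_sub hθ hpos]
  simp only [← integral_derivative_eval, ← intervalIntegral.integral_const_mul]
  constructor
  · exact intervalIntegral.integral_mono_on hst (hc _) (hint _ _) fun r hr =>
      mul_le_mul_of_nonneg_right (ability_mono p hθ hpos hr.1) (hnn r hr)
  · exact intervalIntegral.integral_mono_on hst (hint _ _) (hc _) fun r hr =>
      mul_le_mul_of_nonneg_right (ability_mono p hθ hpos hr.2) (hnn r hr)

lemma RateBetween.continuousOn {w W g : ℝ → ℝ} {a b : ℝ} (h : RateBetween w W g (Set.Icc a b))
    (hW : Continuous W) (hw : Monotone w) (hw0 : ∀ t, 0 < w t)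
    (hWm : MonotoneOn W (Set.Icc a b)) : ContinuousOn g (Set.Icc a b) := by
  have key : ∀ s ∈ Set.Icc a b, ∀ t ∈ Set.Icc a b, s ≤ t →
      |g t - g s| ≤ w b * |W t - W s| := by
    intro s hs t ht hst
    have h1 := h s hs t ht hst
    have h2 : 0 ≤ W t - W s := sub_nonneg.2 (hWm hs ht hst)
    rw [abs_of_nonneg ((mul_nonneg (hw0 s).le h2).trans h1.1), abs_of_nonneg h2]
    exact h1.2.trans (mul_le_mul_of_nonneg_right (hw ht.2) h2)
  intro t ht
  rw [ContinuousWithinAt, tendsto_iff_dist_tendsto_zero]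
  have hlim : Filter.Tendsto (fun s => w b * |W s - W t|) (nhdsWithin t (Set.Icc a b))
      (nhds 0) := by
    have : Continuous fun s => w b * |W s - W t| := by fun_prop
    have := this.tendsto t
    simp only [sub_self, abs_zero, mul_zero] at this
    exact this.mono_left nhdsWithin_le_nhds
  refine squeeze_zero' (.of_forall fun _ => dist_nonneg) ?_ hlim
  filter_upwards [self_mem_nhdsWithin] with s hs
  rw [Real.dist_eq]
  rcases le_total s t with hst | hst
  · rw [abs_sub_comm, abs_sub_comm (W s)]
    exact key s hs t ht hst
  · exact key t ht s hs hst

/-- Immediately to the right of each point `w` is constant, so the two bounds agree and `f - g` has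
right derivative zero. Being continuous, it is constant. -/
lemma RateBetween.unique {w W f g : ℝ → ℝ} (hf : RateBetween w W f (Set.Ico 0 1))
    (hg : RateBetween w W g (Set.Ico 0 1)) (hW : Continuous W) (hw : Monotone w)
    (hw0 : ∀ t, 0 < w t) (hWm : MonotoneOn W (Set.Icc 0 1))
    (hright : ∀ t ∈ Set.Ico (0 : ℝ) 1, ∃ r > t, ∀ s ∈ Set.Ico t r, w s = w t)
    (h0 : f 0 = g 0) {t : ℝ} (ht : t ∈ Set.Ico (0 : ℝ) 1) : f t = g t := by
  have hsub : Set.Icc 0 t ⊆ Set.Ico 0 1 := fun s hs => ⟨hs.1, hs.2.trans_lt ht.2⟩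
  have hfc : ContinuousOn f (Set.Icc 0 t) := RateBetween.continuousOn
    (fun s hs r hr => hf s (hsub hs) r (hsub hr)) hW hw hw0
    (hWm.mono (hsub.trans Set.Ico_subset_Icc_self))
  have hgc : ContinuousOn g (Set.Icc 0 t) := RateBetween.continuousOn
    (fun s hs r hr => hg s (hsub hs) r (hsub hr)) hW hw hw0
    (hWm.mono (hsub.trans Set.Ico_subset_Icc_self))
  have key := constant_of_has_deriv_right_zero (hfc.sub hgc) (fun s hs => by
    have hs1 : s ∈ Set.Ico (0 : ℝ) 1 := hsub ⟨hs.1, hs.2.le⟩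
    obtain ⟨r, hr, hw'⟩ := hright s hs1
    refine (hasDerivWithinAt_const s (Set.Ici s) (f s - g s)).congr_of_eventuallyEq ?_ rfl
    have hmem : Set.Ico s (min r 1) ∈ nhdsWithin s (Set.Ici s) :=
      Ico_mem_nhdsGE (lt_min hr hs1.2)
    filter_upwards [hmem] with x hx
    have hx1 : x ∈ Set.Ico (0 : ℝ) 1 :=
      ⟨hs1.1.trans hx.1, hx.2.trans_le (min_le_right _ _)⟩
    have hwx := hw' x ⟨hx.1, hx.2.trans_le (min_le_left _ _)⟩
    have e1 := hf s hs1 x hx1 hx.1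
    have e2 := hg s hs1 x hx1 hx.1
    rw [hwx] at e1 e2
    simp only [Pi.sub_apply]
    linarith [e1.1, e1.2, e2.1, e2.2]) t ⟨ht.1, le_rfl⟩
  simp only [Pi.sub_apply, h0, sub_self] at key
  linarith

lemma ability_right_const {K : ℕ} [NeZero K] {p : Fin K → ℝ} (θ : Fin K → ℝ)
    (hp : ∀ k, 0 < p k) (hp1 : ∑ k, p k = 1) (t : ℝ) (ht : t ∈ Set.Ico (0 : ℝ) 1) :
    ∃ r > t, ∀ s ∈ Set.Ico t r, ability p θ s = ability p θ t := by
  refine ⟨_, lt_lowerMass_typeAt_add hp1 ht.2, fun s hs => ?_⟩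
  unfold ability
  rw [typeAt_eq hp hp1 ((lowerMass_typeAt_le ht.1).trans hs.1) hs.2]

lemma scaledCost_monotoneOn {N K : ℕ} [NeZero K] (p : Fin K → ℝ) {θ : Fin K → ℝ}
    {v : Fin (N + 1) → ℝ} (hv : Monotone v) (hθ : StrictAnti θ) (hpos : ∀ k, 0 < θ k) :
    MonotoneOn (scaledCost p θ v) (Set.Icc 0 1) := fun s hs t ht hst => by
  have h1 := (scaledCost_rateBetween p hv hθ hpos s hs t ht hst).1
  have h2 := mul_nonneg (ability_pos p hpos s).le
    (sub_nonneg.2 (monotoneOn_prizePoly hv hs ht hst))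
  simp only at h2
  linarith

lemma scaledCost_strictMonoOn {N K : ℕ} [NeZero K] (p : Fin K → ℝ) {θ : Fin K → ℝ}
    {v : Fin (N + 1) → ℝ} (hv : Monotone v) (hlt : v 0 < v (Fin.last N))
    (hθ : StrictAnti θ) (hpos : ∀ k, 0 < θ k) :
    StrictMonoOn (scaledCost p θ v) (Set.Icc 0 1) := fun s hs t ht hst => by
  have h1 := (scaledCost_rateBetween p hv hθ hpos s hs t ht hst.le).1
  have h2 := mul_pos (ability_pos p hpos s)
    (sub_pos.2 (strictMonoOn_prizePoly hv hlt hs ht hst))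
  simp only at h2
  linarith

lemma scaledCost_nonneg {N K : ℕ} [NeZero K] (p : Fin K → ℝ) {θ : Fin K → ℝ}
    {v : Fin (N + 1) → ℝ} (hv : Monotone v) (hθ : StrictAnti θ) (hpos : ∀ k, 0 < θ k)
    {t : ℝ} (ht : t ∈ Set.Icc (0 : ℝ) 1) : 0 ≤ scaledCost p θ v t := by
  have := scaledCost_monotoneOn p hv hθ hpos ⟨le_rfl, zero_le_one⟩ ht ht.1
  rwa [scaledCost_zero] at this

/-! ### Inverse cost and equilibrium effort by quantile. -/

/-- The inverse of a cost function on `[0, ∞)`. -/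
def costInv (c : ℝ → ℝ) : ℝ → ℝ := Function.invFunOn c (Set.Ici 0)

section costInv
variable {c : ℝ → ℝ}

lemma IsCost.surjOn (hc : IsCost c) {y : ℝ} (hy : 0 ≤ y) : ∃ x ∈ Set.Ici (0 : ℝ), c x = y := by
  obtain ⟨b, hb⟩ := ((hc.tendsto.eventually_ge_atTop y).and
    (Filter.eventually_ge_atTop 0)).exists
  have := intermediate_value_Icc hb.2 (hc.continuousOn.mono Set.Icc_subset_Ici_self)
  obtain ⟨x, hx, hxy⟩ := this ⟨by rw [hc.zero]; exact hy, hb.1⟩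
  exact ⟨x, hx.1, hxy⟩

lemma IsCost.costInv_nonneg (hc : IsCost c) {y : ℝ} (hy : 0 ≤ y) : 0 ≤ costInv c y :=
  Function.invFunOn_mem (hc.surjOn hy)

lemma IsCost.apply_costInv (hc : IsCost c) {y : ℝ} (hy : 0 ≤ y) : c (costInv c y) = y :=
  Function.invFunOn_eq (hc.surjOn hy)

lemma IsCost.nonneg (hc : IsCost c) {x : ℝ} (hx : 0 ≤ x) : 0 ≤ c x := by
  rw [← hc.zero]
  exact hc.strictMonoOn.monotoneOn Set.self_mem_Ici hx hx

lemma IsCost.costInv_apply (hc : IsCost c) {x : ℝ} (hx : 0 ≤ x) : costInv c (c x) = x :=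
  hc.strictMonoOn.injOn (hc.costInv_nonneg (hc.nonneg hx)) hx (hc.apply_costInv (hc.nonneg hx))

lemma IsCost.costInv_zero (hc : IsCost c) : costInv c 0 = 0 := by
  simpa [hc.zero] using hc.costInv_apply le_rfl

lemma IsCost.costInv_strictMonoOn (hc : IsCost c) : StrictMonoOn (costInv c) (Set.Ici 0) := by
  intro x hx y hy hxy
  rw [← hc.strictMonoOn.lt_iff_lt (hc.costInv_nonneg hx) (hc.costInv_nonneg hy),
    hc.apply_costInv hx, hc.apply_costInv hy]
  exact hxy

lemma IsCost.convexOn_costInv (hc : IsCost c) (hconc : ConcaveOn ℝ (Set.Ici 0) c) :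
    ConvexOn ℝ (Set.Ici 0) (costInv c) := by
  refine ⟨convex_Ici 0, fun x hx y hy a b ha hb hab => ?_⟩
  have hx' := hc.costInv_nonneg hx
  have hy' := hc.costInv_nonneg hy
  have hm : (0 : ℝ) ≤ a • x + b • y := convex_Ici (0 : ℝ) hx hy ha hb hab
  have hm' : (0 : ℝ) ≤ a • costInv c x + b • costInv c y := convex_Ici (0 : ℝ) hx' hy' ha hb hab
  rw [← hc.strictMonoOn.le_iff_le (hc.costInv_nonneg hm) hm', hc.apply_costInv hm]
  have := hconc.2 hx' hy' ha hb hab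
  rwa [hc.apply_costInv hx, hc.apply_costInv hy] at this

lemma IsCost.strictConvexOn_costInv (hc : IsCost c) (hconc : StrictConcaveOn ℝ (Set.Ici 0) c) :
    StrictConvexOn ℝ (Set.Ici 0) (costInv c) := by
  refine ⟨convex_Ici 0, fun x hx y hy hxy a b ha hb hab => ?_⟩
  have hx' := hc.costInv_nonneg hx
  have hy' := hc.costInv_nonneg hy
  have hm : (0 : ℝ) ≤ a • x + b • y := convex_Ici (0 : ℝ) hx hy ha.le hb.le hab
  have hm' : (0 : ℝ) ≤ a • costInv c x + b • costInv c y :=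
    convex_Ici (0 : ℝ) hx' hy' ha.le hb.le hab
  rw [← hc.strictMonoOn.lt_iff_lt (hc.costInv_nonneg hm) hm', hc.apply_costInv hm]
  have := hconc.2 hx' hy' (hc.costInv_strictMonoOn.injOn.ne hx hy hxy) ha hb hab
  rwa [hc.apply_costInv hx, hc.apply_costInv hy] at this

end costInv

/-- The equilibrium effort at quantile `t`. -/
def quantileEffort {N K : ℕ} [NeZero K] (p θ : Fin K → ℝ) (c : ℝ → ℝ) (v : Fin (N + 1) → ℝ)
    (t : ℝ) : ℝ := costInv c (scaledCost p θ v t)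

/-- The equilibrium expected effort. -/
def meanEffort {N K : ℕ} [NeZero K] (p θ : Fin K → ℝ) (c : ℝ → ℝ) (v : Fin (N + 1) → ℝ) : ℝ :=
  ∫ t in (0 : ℝ)..1, quantileEffort p θ c v t

lemma quantileEffort_monotoneOn {N K : ℕ} [NeZero K] (p : Fin K → ℝ) {θ : Fin K → ℝ}
    {c : ℝ → ℝ} (hc : IsCost c)
    {v : Fin (N + 1) → ℝ} (hv : Monotone v) (hθ : StrictAnti θ) (hpos : ∀ k, 0 < θ k) :
    MonotoneOn (quantileEffort p θ c v) (Set.Icc 0 1) := fun _ hs _ ht hst =>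
  hc.costInv_strictMonoOn.monotoneOn (scaledCost_nonneg p hv hθ hpos hs)
    (scaledCost_nonneg p hv hθ hpos ht) (scaledCost_monotoneOn p hv hθ hpos hs ht hst)

lemma quantileEffort_strictMonoOn {N K : ℕ} [NeZero K] (p : Fin K → ℝ) {θ : Fin K → ℝ}
    {c : ℝ → ℝ} (hc : IsCost c) {v : Fin (N + 1) → ℝ} (hv : Monotone v)
    (hlt : v 0 < v (Fin.last N)) (hθ : StrictAnti θ) (hpos : ∀ k, 0 < θ k) :
    StrictMonoOn (quantileEffort p θ c v) (Set.Icc 0 1) := fun _ hs _ ht hst =>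
  hc.costInv_strictMonoOn (scaledCost_nonneg p hv hθ hpos hs)
    (scaledCost_nonneg p hv hθ hpos ht) (scaledCost_strictMonoOn p hv hlt hθ hpos hs ht hst)

lemma intervalIntegrable_quantileEffort {N K : ℕ} [NeZero K] (p : Fin K → ℝ) {θ : Fin K → ℝ}
    {c : ℝ → ℝ} (hc : IsCost c)
    {v : Fin (N + 1) → ℝ} (hv : Monotone v) (hθ : StrictAnti θ) (hpos : ∀ k, 0 < θ k) :
    IntervalIntegrable (quantileEffort p θ c v) volume 0 1 := by
  apply MonotoneOn.intervalIntegrable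
  rw [Set.uIcc_of_le zero_le_one]
  exact quantileEffort_monotoneOn p hc hv hθ hpos

lemma aemeasurable_quantileEffort {N K : ℕ} [NeZero K] (p : Fin K → ℝ) {θ : Fin K → ℝ}
    {c : ℝ → ℝ} (hc : IsCost c)
    {v : Fin (N + 1) → ℝ} (hv : Monotone v) (hθ : StrictAnti θ) (hpos : ∀ k, 0 < θ k) :
    AEMeasurable (quantileEffort p θ c v) (volume.restrict (Set.Ico 0 1)) :=
  aemeasurable_restrict_of_monotoneOn measurableSet_Ico
    ((quantileEffort_monotoneOn p hc hv hθ hpos).mono Set.Ico_subset_Icc_self)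

/-! ### Every symmetric equilibrium has the quantile law. -/

section effortLaw
variable {K : ℕ} {p : Fin K → ℝ} {σ : Fin K → Measure ℝ}

lemma isProbabilityMeasure_effortLaw (hp : ∀ k, 0 < p k) (hp1 : ∑ k, p k = 1)
    (hσ : ∀ k, IsProbabilityMeasure (σ k)) : IsProbabilityMeasure (effortLaw p σ) := by
  constructor
  simp only [effortLaw, Measure.finsetSum_apply, Measure.smul_apply, measure_univ, smul_eq_mul,
    mul_one]
  rw [← ENNReal.ofReal_sum_of_nonneg fun k _ => (hp k).le, hp1, ENNReal.ofReal_one]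

lemma effortLaw_apply (B : Set ℝ) :
    effortLaw p σ B = ∑ k, ENNReal.ofReal (p k) * σ k B := by
  simp [effortLaw, Measure.finsetSum_apply]

lemma effortLaw_real (hp : ∀ k, 0 < p k) (hσ : ∀ k, IsProbabilityMeasure (σ k)) (B : Set ℝ) :
    (effortLaw p σ).real B = ∑ k, p k * (σ k).real B := by
  rw [measureReal_def, effortLaw_apply, ENNReal.toReal_sum]
  · exact Finset.sum_congr rfl fun k _ => by
      rw [ENNReal.toReal_mul, ENNReal.toReal_ofReal (hp k).le]; rfl
  · exact fun k _ => ENNReal.mul_ne_top ENNReal.ofReal_ne_top (measure_ne_top _ _)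

lemma ae_effortLaw {P : ℝ → Prop} (h : ∀ k, ∀ᵐ x ∂(σ k), P x) : ∀ᵐ x ∂(effortLaw p σ), P x := by
  rw [ae_iff, effortLaw_apply]
  exact Finset.sum_eq_zero fun k _ => by rw [ae_iff.1 (h k), mul_zero]

end effortLaw

lemma payoff_eq {N K : ℕ} (θ : Fin K → ℝ) (c : ℝ → ℝ) (p : Fin K → ℝ) (v : Fin (N + 1) → ℝ)
    (σ : Fin K → Measure ℝ) (k : Fin K) (x : ℝ) :
    payoff (parametric θ c) p v σ k x = expectedPrize v (effortLaw p σ) x - θ k * c x := rfl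

/-- The best responses of type `k`. -/
def bestResponses {N K : ℕ} (θ : Fin K → ℝ) (c : ℝ → ℝ) (p : Fin K → ℝ) (v : Fin (N + 1) → ℝ)
    (σ : Fin K → Measure ℝ) (k : Fin K) : Set ℝ :=
  {x | 0 ≤ x ∧ ∀ x', 0 ≤ x' →
    payoff (parametric θ c) p v σ k x' ≤ payoff (parametric θ c) p v σ k x}

section equilibrium
variable {N K : ℕ} {p θ : Fin K → ℝ} {c : ℝ → ℝ} {v : Fin (N + 1) → ℝ} {σ : Fin K → Measure ℝ}

lemma IsSymmetricEquilibrium.ae_mem (h : IsSymmetricEquilibrium (parametric θ c) p v σ)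
    (k : Fin K) : ∀ᵐ x ∂(σ k), x ∈ bestResponses θ c p v σ k := by
  filter_upwards [h.nonneg k, h.best k] with x h1 h2
  exact ⟨h1, h2⟩

/-- More able types exert more effort. -/
lemma bestResponses_le (hθ : StrictAnti θ) (hc : IsCost c) {k l : Fin K} (hkl : k < l) {x y : ℝ}
    (hx : x ∈ bestResponses θ c p v σ k) (hy : y ∈ bestResponses θ c p v σ l) : x ≤ y := by
  rw [← hc.strictMonoOn.le_iff_le hx.1 hy.1]
  -- In the sum of the two best-response inequalities the expected prizes cancel, leaving (θ_k -
  -- θ_l)(c x - c y) ≤ 0.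
  have h1 := hx.2 y hy.1
  have h2 := hy.2 x hx.1
  simp only [payoff_eq] at h1 h2
  have h3 := hθ hkl
  nlinarith

/-- An atom `x` is a best response of some type. Efforts just above it win all ties at `x` for a
vanishing extra cost, whereas `x` itself earns strictly less by `expectedPrize_lt_of_atom`. -/
lemma IsSymmetricEquilibrium.no_atom (hp : ∀ k, 0 < p k) (hp1 : ∑ k, p k = 1) (hc : IsCost c)
    (hv : Monotone v) (hlt : v 0 < v (Fin.last N))
    (h : IsSymmetricEquilibrium (parametric θ c) p v σ) (x : ℝ) : effortLaw p σ {x} = 0 := by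
  have := isProbabilityMeasure_effortLaw hp hp1 h.prob
  by_contra hx
  have hk : ∃ k, σ k {x} ≠ 0 := by
    by_contra! hcon
    exact hx (by rw [effortLaw_apply]; exact Finset.sum_eq_zero fun k _ => by simp [hcon k])
  obtain ⟨k, hk⟩ := hk
  have hbr : x ∈ bestResponses θ c p v σ k := by
    by_contra hcon
    exact hk (measure_mono_null (by rintro _ rfl; exact hcon) (ae_iff.1 (h.ae_mem k)))
  have hlim : Filter.Tendsto (fun y => (prizePoly v).eval ((effortLaw p σ).real (Set.Iic x)) -
      θ k * c y) (nhdsWithin x (Set.Ioi x))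
      (nhds ((prizePoly v).eval ((effortLaw p σ).real (Set.Iic x)) - θ k * c x)) := by
    refine tendsto_const_nhds.sub (tendsto_const_nhds.mul ?_)
    exact (hc.continuousOn x hbr.1).mono_left
      (nhdsWithin_mono x fun y hy => hbr.1.trans (le_of_lt hy))
  have hle := le_of_tendsto hlim (b := payoff (parametric θ c) p v σ k x) (by
    filter_upwards [self_mem_nhdsWithin] with y hy
    refine le_trans ?_ (hbr.2 y (hbr.1.trans (le_of_lt hy)))
    rw [payoff_eq]
    have := eval_Iic_le_expectedPrize hv (effortLaw p σ) hy
    linarith)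
  rw [payoff_eq] at hle
  have := expectedPrize_lt_of_atom hv (effortLaw p σ) hlt hx
  linarith

lemma continuous_measureReal_Iic {μ : Measure ℝ} [IsProbabilityMeasure μ] (h : ∀ x, μ {x} = 0) :
    Continuous fun x => μ.real (Set.Iic x) := by
  have e : (fun x => μ.real (Set.Iic x)) = ProbabilityTheory.cdf μ := by
    ext x
    rw [ProbabilityTheory.cdf_eq_real]
  rw [e, continuous_iff_continuousAt]
  intro x
  rw [(ProbabilityTheory.cdf μ).mono.continuousAt_iff_leftLim_eq_rightLim,
    (ProbabilityTheory.cdf μ).rightLim_eq]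
  have h1 := (ProbabilityTheory.cdf μ).measure_singleton x
  rw [ProbabilityTheory.measure_cdf, h, eq_comm, ENNReal.ofReal_eq_zero] at h1
  exact le_antisymm ((ProbabilityTheory.cdf μ).mono.leftLim_le le_rfl) (by linarith)

/-- The rank of a best response of type `k` lies in the quantile interval of that type. -/
lemma IsSymmetricEquilibrium.rank_mem (hp : ∀ k, 0 < p k)
    (hθ : StrictAnti θ) (hc : IsCost c) (h : IsSymmetricEquilibrium (parametric θ c) p v σ)
    (hna : ∀ x, effortLaw p σ {x} = 0) {k : Fin K} {x : ℝ}
    (hx : x ∈ bestResponses θ c p v σ k) :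
    (effortLaw p σ).real (Set.Iic x) ∈ Set.Icc (lowerMass p k) (lowerMass p k + p k) := by
  have hσ := h.prob
  constructor
  · rw [effortLaw_real hp hσ, lowerMass]
    refine le_trans ?_ (Finset.sum_le_sum_of_subset_of_nonneg (Finset.subset_univ (Finset.Iio k))
      fun j _ _ => mul_nonneg (hp j).le measureReal_nonneg)
    refine Finset.sum_le_sum fun j hj => ?_
    have h1 : σ j (Set.Iic x) = 1 := by
      rw [prob_compl_eq_zero_iff measurableSet_Iic |>.symm]
      refine measure_mono_null (fun y hy => ?_) (ae_iff.1 (h.ae_mem j))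
      exact fun hcon => hy (bestResponses_le hθ hc (Finset.mem_Iio.1 hj) hcon hx)
    rw [measureReal_def, h1, ENNReal.toReal_one, mul_one]
  -- Abler types are excluded only strictly below `x`, hence the passage to `Iio`, which is harmless
  -- without atoms.
  · rw [← measureReal_Iio_eq_Iic (hna x), effortLaw_real hp hσ, lowerMass_add_eq_sum_Iic]
    rw [← Finset.sum_subset (Finset.subset_univ (Finset.Iic k))]
    · exact Finset.sum_le_sum fun j _ => mul_le_of_le_one_right (hp j).le measureReal_le_one
    · intro l _ hl
      have hl : k < l := by simpa using hl
      have h1 : σ l (Set.Iio x) = 0 := by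
        refine measure_mono_null (fun y hy => ?_) (ae_iff.1 (h.ae_mem l))
        exact fun hcon => not_le.2 hy (bestResponses_le hθ hc hl hx hcon)
      rw [measureReal_def, h1, ENNReal.toReal_zero, mul_zero]

/-- In equilibrium, the effort at every quantile is a best response of the type at that
quantile. -/
lemma IsSymmetricEquilibrium.exists_quantile [NeZero K] (hp : ∀ k, 0 < p k)
    (hp1 : ∑ k, p k = 1) (hθ : StrictAnti θ) (hc : IsCost c) (hv : Monotone v)
    (h : IsSymmetricEquilibrium (parametric θ c) p v σ)
    (hna : ∀ x, effortLaw p σ {x} = 0) {t : ℝ} (ht : t ∈ Set.Ico (0 : ℝ) 1) :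
    ∃ x ∈ bestResponses θ c p v σ (typeAt p t), (effortLaw p σ).real (Set.Iic x) = t ∧
      ∀ y, x < y → t < (effortLaw p σ).real (Set.Iic y) := by
  have hprob := isProbabilityMeasure_effortLaw hp hp1 h.prob
  set μ := effortLaw p σ with hμ
  set F : ℝ → ℝ := fun x => μ.real (Set.Iic x) with hF
  have hFc : Continuous F := continuous_measureReal_Iic hna
  have hFm : Monotone F := fun a b hab => measureReal_mono (Set.Iic_subset_Iic.2 hab)
  have hF0 : F 0 = 0 := by
    have h1 : μ (Set.Iio 0) = 0 := by
      refine measure_mono_null (fun y hy => ?_) (ae_iff.1 (ae_effortLaw (p := p) h.nonneg))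
      exact not_le.2 hy
    rw [hF]
    simp only
    rw [← measureReal_Iio_eq_Iic (hna 0), measureReal_def, h1, ENNReal.toReal_zero]
  have hbig : ∃ b, t < F b := by
    have := ProbabilityTheory.tendsto_cdf_atTop μ
    obtain ⟨b, hb⟩ := (this.eventually (lt_mem_nhds ht.2)).exists
    exact ⟨b, by rwa [ProbabilityTheory.cdf_eq_real] at hb⟩
  obtain ⟨b, hb⟩ := hbig
  set S : Set ℝ := {x | F x ≤ t} with hS
  have h0S : (0 : ℝ) ∈ S := by simp only [hS, Set.mem_ofPred_eq, hF0]; exact ht.1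
  have hbdd : BddAbove S := ⟨b, fun x hx => (hFm.reflect_lt (lt_of_le_of_lt hx hb)).le⟩
  have hcl : IsClosed S := isClosed_le hFc continuous_const
  -- The largest effort of rank at most `t`, so that there is mass immediately to its right.
  set x := sSup S with hxdef
  have hxS : F x ≤ t := hcl.csSup_mem ⟨0, h0S⟩ hbdd
  have hx0 : 0 ≤ x := le_csSup hbdd h0S
  have habove : ∀ y, x < y → t < F y := fun y hy => by
    by_contra! hcon
    exact absurd (le_csSup hbdd hcon) (not_le.2 hy)
  have hFx : F x = t := by
    refine le_antisymm hxS ?_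
    have : Filter.Tendsto F (nhdsWithin x (Set.Ioi x)) (nhds (F x)) :=
      (hFc.tendsto x).mono_left nhdsWithin_le_nhds
    exact ge_of_tendsto this (by filter_upwards [self_mem_nhdsWithin] with y hy using
      (habove y hy).le)
  refine ⟨x, ⟨hx0, fun x' hx' => ?_⟩, hFx, habove⟩
  set k := typeAt p t
  -- A profitable deviation `x'` from `x` also beats every effort slightly above `x`. Those efforts
  -- have positive mass, so one of them is a best response of some type; its rank lies above `t` and
  -- below the upper end of the interval of `k`, which forces that type to be `k`.
  by_contra! hcon
  have hpay : ∀ y, payoff (parametric θ c) p v σ k y = (prizePoly v).eval (F y) - θ k * c y :=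
    fun y => by rw [payoff_eq, expectedPrize_eq hv _ (hna y)]
  have hpc : Filter.Tendsto (payoff (parametric θ c) p v σ k) (nhdsWithin x (Set.Ioi x))
      (nhds (payoff (parametric θ c) p v σ k x)) := by
    simp_rw [funext hpay]
    refine Filter.Tendsto.sub ?_ (tendsto_const_nhds.mul ?_)
    · exact (((prizePoly v).continuous.comp hFc).tendsto x).mono_left nhdsWithin_le_nhds
    · exact (hc.continuousOn x hx0).mono_left
        (nhdsWithin_mono x fun y hy => hx0.trans (le_of_lt hy))
  have e1 := hpc.eventually (gt_mem_nhds hcon)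
  have e2 : ∀ᶠ y in nhdsWithin x (Set.Ioi x), F y < lowerMass p k + p k := by
    refine ((hFc.tendsto x).mono_left nhdsWithin_le_nhds).eventually (gt_mem_nhds ?_)
    rw [hFx]
    exact lt_lowerMass_typeAt_add hp1 ht.2
  obtain ⟨r, hr, hr'⟩ := mem_nhdsGT_iff_exists_Ioo_subset.1 (e1.and e2)
  have hxr : x < r := hr
  obtain ⟨m, hxm, hmr⟩ := exists_between hxr
  have hpos : μ (Set.Ioc x m) ≠ 0 := by
    intro hzero
    have h1 : μ (Set.Iic m) ≤ μ (Set.Iic x) := by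
      rw [← Set.Iic_union_Ioc_eq_Iic hxm.le]
      exact (measure_union_le _ _).trans (by rw [hzero, add_zero])
    have h2 : F m ≤ F x := ENNReal.toReal_mono (measure_ne_top _ _) h1
    have := habove m hxm
    linarith
  have hae : ∀ᵐ y ∂μ, ∃ j, y ∈ bestResponses θ c p v σ j := ae_effortLaw fun j => by
    filter_upwards [h.ae_mem j] with y hy using ⟨j, hy⟩
  have hex : ∃ y ∈ Set.Ioc x m, ∃ j, y ∈ bestResponses θ c p v σ j := by
    by_contra! hno
    exact hpos (measure_mono_null (fun y hy => by
      simp only [Set.mem_ofPred_eq, not_exists]; exact hno y hy)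
      (ae_iff.1 hae))
  obtain ⟨y, hy, j, hyj⟩ := hex
  obtain ⟨hy1, hy2⟩ := hr' ⟨hy.1, hy.2.trans_lt hmr⟩
  have hrank := h.rank_mem hp hθ hc hna hyj
  have hFy : t < F y := habove y hy.1
  have hjk : j = k := by
    have hk := lowerMass_typeAt_le (p := p) ht.1
    rcases lt_trichotomy j k with hj | hj | hj
    · have := lowerMass_add_le hp hj
      have := hrank.2
      linarith
    · exact hj
    · have := lowerMass_add_le hp hj
      have := hrank.1
      linarith
  subst hjk
  exact absurd (hyj.2 x' hx') (not_le.2 hy1)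

lemma IsSymmetricEquilibrium.effortLaw_eq [NeZero K] (hp : ∀ k, 0 < p k)
    (hp1 : ∑ k, p k = 1) (hθ : StrictAnti θ) (hpos : ∀ k, 0 < θ k) (hc : IsCost c)
    (hv : Monotone v) (hlt : v 0 < v (Fin.last N))
    (h : IsSymmetricEquilibrium (parametric θ c) p v σ) :
    effortLaw p σ = (volume.restrict (Set.Ico 0 1)).map (quantileEffort p θ c v) := by
  have hprob := isProbabilityMeasure_effortLaw hp hp1 h.prob
  have hna := h.no_atom hp hp1 hc hv hlt
  choose! X hX hFX hXlt using fun t ht => h.exists_quantile hp hp1 hθ hc hv hna (t := t) ht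
  have hg : RateBetween (ability p θ) (fun t => (prizePoly v).eval t) (fun t => c (X t))
      (Set.Ico 0 1) := by
    intro s hs t ht hst
    have h1 := (hX s hs).2 _ (hX t ht).1
    have h2 := (hX t ht).2 _ (hX s hs).1
    simp only [payoff_eq, expectedPrize_eq hv _ (hna _), hFX s hs, hFX t ht] at h1 h2
    constructor
    · rw [ability, inv_mul_le_iff₀ (hpos _)]
      simp only
      linarith
    · rw [ability, le_inv_mul_iff₀ (hpos _)]
      simp only
      linarith
  have h00 : (0 : ℝ) ∈ Set.Ico (0 : ℝ) 1 := ⟨le_rfl, one_pos⟩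
  -- Effort `X 0` has rank 0 and earns the lowest expected prize, which zero effort secures for
  -- free.
  have hX0 : c (X 0) = 0 := by
    refine le_antisymm ?_ (hc.nonneg (hX 0 h00).1)
    have h1 := (hX 0 h00).2 0 le_rfl
    simp only [payoff_eq, expectedPrize_eq hv _ (hna _), hFX 0 h00, hc.zero] at h1
    have h2 : (prizePoly v).eval 0 ≤ (prizePoly v).eval ((effortLaw p σ).real (Set.Iic 0)) :=
      monotoneOn_prizePoly hv ⟨le_rfl, zero_le_one⟩ ⟨measureReal_nonneg, measureReal_le_one⟩
        measureReal_nonneg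
    have h3 : θ (typeAt p 0) * c (X 0) ≤ 0 := by linarith
    exact nonpos_of_mul_nonpos_right h3 (hpos _)
  have hXq : ∀ t ∈ Set.Ico (0 : ℝ) 1, quantileEffort p θ c v t = X t := by
    intro t ht
    have hs : RateBetween (ability p θ) (fun t => (prizePoly v).eval t) (scaledCost p θ v)
        (Set.Ico 0 1) := fun a ha b hb => scaledCost_rateBetween p hv hθ hpos a
          (Set.Ico_subset_Icc_self ha) b (Set.Ico_subset_Icc_self hb)
    have := RateBetween.unique hs hg (prizePoly v).continuous (ability_mono p hθ hpos)
      (ability_pos p hpos) (monotoneOn_prizePoly hv) (ability_right_const θ hp hp1)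
      (by simp only [hX0, scaledCost_zero]) ht
    rw [quantileEffort, this, hc.costInv_apply (hX t ht).1]
  have hmeas : AEMeasurable (quantileEffort p θ c v) (volume.restrict (Set.Ico 0 1)) :=
    aemeasurable_quantileEffort p hc hv hθ hpos
  refine Measure.ext_of_Iic _ _ fun y => ?_
  rw [Measure.map_apply_of_aemeasurable hmeas measurableSet_Iic,
    Measure.restrict_apply' measurableSet_Ico]
  set F := (effortLaw p σ).real (Set.Iic y) with hF
  have hF1 : F ≤ 1 := measureReal_le_one
  have hFy : effortLaw p σ (Set.Iic y) = ENNReal.ofReal F := (ofReal_measureReal).symm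
  rw [hFy]
  -- The quantiles with effort at most `y` form a set between `[0, F)` and `[0, F]`.
  refine le_antisymm ?_ ?_
  · calc ENNReal.ofReal F = volume (Set.Ico 0 F) := by rw [Real.volume_Ico, sub_zero]
      _ ≤ _ := measure_mono fun t ht => by
        have ht1 : t ∈ Set.Ico (0 : ℝ) 1 := ⟨ht.1, ht.2.trans_le hF1⟩
        refine ⟨?_, ht1⟩
        rw [Set.mem_preimage, hXq t ht1, Set.mem_Iic]
        by_contra! hcon
        have : F ≤ (effortLaw p σ).real (Set.Iic (X t)) :=
          measureReal_mono (Set.Iic_subset_Iic.2 hcon.le)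
        rw [hFX t ht1] at this
        exact absurd ht.2 (not_lt.2 this)
  · calc _ ≤ volume (Set.Icc 0 F) := measure_mono fun t ht => by
          obtain ⟨hty, ht1⟩ := ht
          rw [Set.mem_preimage, hXq t ht1, Set.mem_Iic] at hty
          refine ⟨ht1.1, ?_⟩
          rw [← hFX t ht1]
          exact measureReal_mono (Set.Iic_subset_Iic.2 hty)
      _ = ENNReal.ofReal F := by rw [Real.volume_Icc, sub_zero]

lemma prize_eq_of_const (hv : Monotone v) (heq : v 0 = v (Fin.last N)) (x : ℝ) (y : Fin N → ℝ) :
    prize v x y = v 0 :=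
  le_antisymm ((prize_le_prizeAt hv x y).trans (heq ▸ (prizeAt_mem hv _).2))
    ((prizeAt_mem hv _).1.trans (prizeAt_numBelow_le_prize hv x y))

lemma expectedPrize_of_const (hv : Monotone v) (heq : v 0 = v (Fin.last N)) (μ : Measure ℝ)
    [IsProbabilityMeasure μ] (x : ℝ) : expectedPrize v μ x = v 0 := by
  simp [expectedPrize, prize_eq_of_const hv heq]

lemma quantileEffort_of_const [NeZero K] (hθ : StrictAnti θ) (hpos : ∀ k, 0 < θ k)
    (hc : IsCost c) (hv : Monotone v) (heq : v 0 = v (Fin.last N)) {t : ℝ}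
    (ht : t ∈ Set.Icc (0 : ℝ) 1) : quantileEffort p θ c v t = 0 := by
  have hW := monotoneOn_prizePoly hv ht ⟨zero_le_one, le_rfl⟩ ht.2
  simp only [prizePoly_eval_one, ← heq] at hW
  have h1 := (scaledCost_rateBetween p hv hθ hpos 0 ⟨le_rfl, zero_le_one⟩ t ht ht.1).2
  simp only [prizePoly_eval_zero, scaledCost_zero, sub_zero] at h1
  have h2 : scaledCost p θ v t = 0 := le_antisymm
    (h1.trans (mul_nonpos_of_nonneg_of_nonpos (ability_pos p hpos t).le (by linarith)))
    (scaledCost_nonneg p hv hθ hpos ht)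
  rw [quantileEffort, h2, hc.costInv_zero]

lemma IsSymmetricEquilibrium.mean_eq [NeZero K] (hp : ∀ k, 0 < p k)
    (hp1 : ∑ k, p k = 1) (hθ : StrictAnti θ) (hpos : ∀ k, 0 < θ k) (hc : IsCost c)
    (hv : Monotone v) (h : IsSymmetricEquilibrium (parametric θ c) p v σ) :
    Integrable (fun x : ℝ => x) (effortLaw p σ) ∧
      ∫ x, x ∂(effortLaw p σ) = meanEffort p θ c v := by
  rcases (hv (Fin.zero_le (Fin.last N))).lt_or_eq with hlt | heq
  · rw [h.effortLaw_eq hp hp1 hθ hpos hc hv hlt]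
    have hmeas : AEMeasurable (quantileEffort p θ c v) (volume.restrict (Set.Ico 0 1)) :=
    aemeasurable_quantileEffort p hc hv hθ hpos
    have hint := (intervalIntegrable_iff_integrableOn_Ico_of_le zero_le_one).1
      (intervalIntegrable_quantileEffort p hc hv hθ hpos)
    have hid : AEStronglyMeasurable (fun x : ℝ => x)
        ((volume.restrict (Set.Ico 0 1)).map (quantileEffort p θ c v)) :=
      measurable_id.aestronglyMeasurable
    constructor
    · rw [integrable_map_measure hid hmeas]
      exact hint
    · rw [integral_map hmeas hid, meanEffort,
        intervalIntegral.integral_of_le zero_le_one, integral_Ioc_eq_integral_Ioo,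
        integral_Ico_eq_integral_Ioo]
  -- With equal prizes the payoff is a constant minus the cost, so zero is the only best response.
  · have hprob := isProbabilityMeasure_effortLaw hp hp1 h.prob
    have hz : (fun x : ℝ => x) =ᵐ[effortLaw p σ] fun _ => 0 := ae_effortLaw fun k => by
      filter_upwards [h.ae_mem k] with x hx
      have h1 := hx.2 0 le_rfl
      simp only [payoff_eq, expectedPrize_of_const hv heq, hc.zero] at h1
      have h3 : θ k * c x ≤ 0 := by linarith
      have h2 : c x ≤ c 0 := by
        rw [hc.zero]
        exact nonpos_of_mul_nonpos_right h3 (hpos _)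
      exact le_antisymm ((hc.strictMonoOn.le_iff_le hx.1 Set.self_mem_Ici).1 h2) hx.1
    refine ⟨(integrable_congr hz).2 (integrable_zero _ _ _), ?_⟩
    rw [integral_congr_ae hz, integral_zero, meanEffort]
    symm
    rw [intervalIntegral.integral_congr (g := fun _ => 0)]
    · simp
    · intro t ht
      rw [Set.uIcc_of_le zero_le_one] at ht
      exact quantileEffort_of_const hθ hpos hc hv heq ht

lemma isSymmetricEquilibrium_dirac (hp : ∀ k, 0 < p k) (hp1 : ∑ k, p k = 1)
    (hpos : ∀ k, 0 < θ k) (hc : IsCost c) (hv : Monotone v) (heq : v 0 = v (Fin.last N)) :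
    IsSymmetricEquilibrium (parametric θ c) p v fun _ => Measure.dirac 0 := by
  have hμ := isProbabilityMeasure_effortLaw (σ := fun _ : Fin K => Measure.dirac (0 : ℝ)) hp hp1
    fun _ => inferInstance
  refine ⟨fun _ => inferInstance, fun k => ?_, fun k => ?_⟩
  · rw [ae_dirac_iff measurableSet_Ici]
  · rw [ae_dirac_eq]
    intro x hx
    simp only [payoff_eq, expectedPrize_of_const hv heq, hc.zero]
    have := mul_nonneg (hpos k).le (hc.nonneg hx)
    linarith

end equilibrium

/-! ### Existence of a symmetric equilibrium. -/

section existence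
variable {N K : ℕ} [NeZero K] {p θ : Fin K → ℝ} {c : ℝ → ℝ} {v : Fin (N + 1) → ℝ}

/-- The strategy of type `k` whose effort has the quantiles `quantileEffort` on the quantile
interval of that type. -/
def quantileStrategy (p θ : Fin K → ℝ) (c : ℝ → ℝ) (v : Fin (N + 1) → ℝ) (k : Fin K) :
    Measure ℝ :=
  (ENNReal.ofReal (p k))⁻¹ •
    (volume.restrict (Set.Ico (lowerMass p k) (lowerMass p k + p k))).map (quantileEffort p θ c v)

lemma iUnion_quantileIntervals (hp : ∀ k, 0 < p k) (hp1 : ∑ k, p k = 1) :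
    ⋃ k, Set.Ico (lowerMass p k) (lowerMass p k + p k) = Set.Ico 0 1 := by
  ext t
  simp only [Set.mem_iUnion, Set.mem_Ico]
  constructor
  · rintro ⟨k, h1, h2⟩
    exact ⟨(lowerMass_nonneg hp k).trans h1, h2.trans_le (lowerMass_add_le_one hp hp1 k)⟩
  · rintro ⟨h1, h2⟩
    exact ⟨typeAt p t, lowerMass_typeAt_le h1, lt_lowerMass_typeAt_add hp1 h2⟩

lemma quantileInterval_subset (hp : ∀ k, 0 < p k) (hp1 : ∑ k, p k = 1) (k : Fin K) :
    Set.Ico (lowerMass p k) (lowerMass p k + p k) ⊆ Set.Ico 0 1 := by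
  rw [← iUnion_quantileIntervals hp hp1]
  exact Set.subset_iUnion (fun k => Set.Ico (lowerMass p k) (lowerMass p k + p k)) k

lemma effortLaw_quantileStrategy (hp : ∀ k, 0 < p k) (hp1 : ∑ k, p k = 1) (hθ : StrictAnti θ)
    (hpos : ∀ k, 0 < θ k) (hc : IsCost c) (hv : Monotone v) :
    effortLaw p (quantileStrategy p θ c v) =
      (volume.restrict (Set.Ico 0 1)).map (quantileEffort p θ c v) := by
  have hm := aemeasurable_quantileEffort p hc hv hθ hpos
  have hdisj : Pairwise (Function.onFun Disjoint
      fun k => Set.Ico (lowerMass p k) (lowerMass p k + p k)) := by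
    intro j k hjk
    refine Set.disjoint_left.2 fun t hj hk => hjk ?_
    rw [← typeAt_eq hp hp1 hj.1 hj.2, typeAt_eq hp hp1 hk.1 hk.2]
  ext B hB
  rw [effortLaw_apply, Measure.map_apply_of_aemeasurable hm hB,
    ← iUnion_quantileIntervals hp hp1, Measure.restrict_iUnion hdisj fun _ => measurableSet_Ico,
    Measure.sum_fintype, Measure.finsetSum_apply]
  refine Finset.sum_congr rfl fun k _ => ?_
  rw [quantileStrategy, Measure.smul_apply, Measure.map_apply_of_aemeasurable
    (hm.mono_measure (Measure.restrict_mono (quantileInterval_subset hp hp1 k) le_rfl)) hB,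
    smul_eq_mul, ← mul_assoc, ENNReal.mul_inv_cancel (by simpa using hp k) ENNReal.ofReal_ne_top,
    one_mul]

lemma measureReal_Iic_quantileEffort (hθ : StrictAnti θ) (hpos : ∀ k, 0 < θ k) (hc : IsCost c)
    (hv : Monotone v) (hlt : v 0 < v (Fin.last N)) {t : ℝ} (ht : t ∈ Set.Icc (0 : ℝ) 1) :
    ((volume.restrict (Set.Ico 0 1)).map (quantileEffort p θ c v)).real
      (Set.Iic (quantileEffort p θ c v t)) = t := by
  have hm := aemeasurable_quantileEffort p hc hv hθ hpos
  rw [measureReal_def, Measure.map_apply_of_aemeasurable hm measurableSet_Iic,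
    Measure.restrict_apply' measurableSet_Ico]
  have hset : quantileEffort p θ c v ⁻¹' Set.Iic (quantileEffort p θ c v t) ∩ Set.Ico 0 1 =
      Set.Icc 0 t ∩ Set.Ico 0 1 := by
    ext s
    simp only [Set.mem_inter_iff, Set.mem_preimage, Set.mem_Iic, and_congr_left_iff]
    intro hs
    rw [(quantileEffort_strictMonoOn p hc hv hlt hθ hpos).le_iff_le
      (Set.Ico_subset_Icc_self hs) ht]
    exact ⟨fun h => ⟨hs.1, h⟩, fun h => h.2⟩
  have hvol : volume (Set.Icc 0 t ∩ Set.Ico 0 1) = ENNReal.ofReal t := by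
    refine le_antisymm ?_ ?_
    · refine (measure_mono Set.inter_subset_left).trans ?_
      rw [Real.volume_Icc, sub_zero]
    · calc ENNReal.ofReal t = volume (Set.Ico 0 t) := by rw [Real.volume_Ico, sub_zero]
        _ ≤ volume (Set.Icc 0 t ∩ Set.Ico 0 1) := measure_mono fun s hs => ⟨⟨hs.1, hs.2.le⟩, hs.1, hs.2.trans_le ht.2⟩
  rw [hset, hvol, ENNReal.toReal_ofReal ht.1]

lemma map_quantileEffort_singleton (hθ : StrictAnti θ) (hpos : ∀ k, 0 < θ k) (hc : IsCost c)
    (hv : Monotone v) (hlt : v 0 < v (Fin.last N)) (x : ℝ) :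
    ((volume.restrict (Set.Ico 0 1)).map (quantileEffort p θ c v)) {x} = 0 := by
  have hm := aemeasurable_quantileEffort p hc hv hθ hpos
  rw [Measure.map_apply_of_aemeasurable hm (measurableSet_singleton x),
    Measure.restrict_apply' measurableSet_Ico]
  refine Set.Subsingleton.measure_zero (fun s hs t ht => ?_) _
  exact (quantileEffort_strictMonoOn p hc hv hlt hθ hpos).injOn (Set.Ico_subset_Icc_self hs.2)
    (Set.Ico_subset_Icc_self ht.2) (hs.1.trans ht.1.symm)

lemma apply_quantileEffort (hθ : StrictAnti θ) (hpos : ∀ k, 0 < θ k) (hc : IsCost c)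
    (hv : Monotone v) {t : ℝ} (ht : t ∈ Set.Icc (0 : ℝ) 1) :
    c (quantileEffort p θ c v t) = scaledCost p θ v t :=
  hc.apply_costInv (scaledCost_nonneg p hv hθ hpos ht)

lemma quantileEffort_nonneg (hθ : StrictAnti θ) (hpos : ∀ k, 0 < θ k) (hc : IsCost c)
    (hv : Monotone v) {t : ℝ} (ht : t ∈ Set.Icc (0 : ℝ) 1) : 0 ≤ quantileEffort p θ c v t :=
  hc.costInv_nonneg (scaledCost_nonneg p hv hθ hpos ht)

/-- The quantile strategies are best responses to each other. -/
lemma payoff_le_payoff_quantileEffort (hp : ∀ k, 0 < p k) (hp1 : ∑ k, p k = 1)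
    (hθ : StrictAnti θ) (hpos : ∀ k, 0 < θ k) (hc : IsCost c) (hv : Monotone v)
    (hlt : v 0 < v (Fin.last N)) {t : ℝ} (ht : t ∈ Set.Ico (0 : ℝ) 1) {x : ℝ} (hx : 0 ≤ x) :
    payoff (parametric θ c) p v (quantileStrategy p θ c v) (typeAt p t) x ≤
      payoff (parametric θ c) p v (quantileStrategy p θ c v) (typeAt p t)
        (quantileEffort p θ c v t) := by
  have ht' := Set.Ico_subset_Icc_self ht
  have hprob : IsProbabilityMeasure
      ((volume.restrict (Set.Ico (0 : ℝ) 1)).map (quantileEffort p θ c v)) := by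
    have : IsProbabilityMeasure (volume.restrict (Set.Ico (0 : ℝ) 1)) := ⟨by simp⟩
    exact Measure.isProbabilityMeasure_map (aemeasurable_quantileEffort p hc hv hθ hpos)
  have hna := map_quantileEffort_singleton (p := p) hθ hpos hc hv hlt
  simp only [payoff_eq, effortLaw_quantileStrategy hp hp1 hθ hpos hc hv,
    expectedPrize_eq hv _ (hna _), measureReal_Iic_quantileEffort hθ hpos hc hv hlt ht',
    apply_quantileEffort hθ hpos hc hv ht']
  set F := ((volume.restrict (Set.Ico (0 : ℝ) 1)).map (quantileEffort p θ c v)).real (Set.Iic x)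
    with hF
  -- Some quantile `s` does at least as well as `x`: its rank is no lower and its cost no higher. If
  -- `x` costs at least as much as the top effort, `s = 1` serves. It remains to compare `s` with
  -- `t`, which is an incentive constraint.
  have hex : ∃ s ∈ Set.Icc (0 : ℝ) 1, F ≤ s ∧ scaledCost p θ v s ≤ c x := by
    rcases le_total (c x) (scaledCost p θ v 1) with h | h
    · have hivt := intermediate_value_Icc (zero_le_one (α := ℝ))
        (continuous_scaledCost (p := p) (v := v) hθ hpos).continuousOn
      obtain ⟨s, hs, hsx⟩ := hivt ⟨by rw [scaledCost_zero]; exact hc.nonneg hx, h⟩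
      have hq : quantileEffort p θ c v s = x := by rw [quantileEffort, hsx, hc.costInv_apply hx]
      refine ⟨s, hs, le_of_eq ?_, hsx.le⟩
      rw [hF, ← hq]
      exact measureReal_Iic_quantileEffort hθ hpos hc hv hlt hs
    · exact ⟨1, ⟨zero_le_one, le_rfl⟩, measureReal_le_one, h⟩
  obtain ⟨s, hs, hFs, hsc⟩ := hex
  have hW : (prizePoly v).eval F ≤ (prizePoly v).eval s :=
    monotoneOn_prizePoly hv ⟨measureReal_nonneg, measureReal_le_one⟩ hs hFs
  have hcost := mul_le_mul_of_nonneg_left hsc (hpos (typeAt p t)).le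
  have hrate := scaledCost_rateBetween p hv hθ hpos
  rcases le_total t s with hts | hts
  · have h1 := (hrate t ht' s hs hts).1
    rw [ability, inv_mul_le_iff₀ (hpos _)] at h1
    simp only at h1
    linarith
  · have h1 := (hrate s hs t ht' hts).2
    rw [ability, le_inv_mul_iff₀ (hpos _)] at h1
    simp only at h1
    linarith

lemma isSymmetricEquilibrium_quantileStrategy (hp : ∀ k, 0 < p k) (hp1 : ∑ k, p k = 1)
    (hθ : StrictAnti θ) (hpos : ∀ k, 0 < θ k) (hc : IsCost c) (hv : Monotone v)
    (hlt : v 0 < v (Fin.last N)) :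
    IsSymmetricEquilibrium (parametric θ c) p v (quantileStrategy p θ c v) := by
  have hm := fun k => (aemeasurable_quantileEffort p hc hv hθ hpos).mono_measure
    (Measure.restrict_mono (quantileInterval_subset hp hp1 k) le_rfl)
  have hprob : ∀ k, IsProbabilityMeasure (quantileStrategy p θ c v k) := fun k => ⟨by
    rw [quantileStrategy, Measure.smul_apply, Measure.map_apply_of_aemeasurable (hm k)
      MeasurableSet.univ, Set.preimage_univ, Measure.restrict_apply_univ, Real.volume_Ico,
      add_sub_cancel_left, smul_eq_mul, ENNReal.inv_mul_cancel (by simpa using hp k)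
      ENNReal.ofReal_ne_top]⟩
  have hae : ∀ (k : Fin K) (S : Set ℝ), MeasurableSet S →
      (∀ t ∈ Set.Ico (lowerMass p k) (lowerMass p k + p k), quantileEffort p θ c v t ∈ S) →
      ∀ᵐ x ∂(quantileStrategy p θ c v k), x ∈ S := by
    intro k S hS h
    refine Measure.ae_smul_measure ?_ _
    refine (ae_map_iff (p := fun x => x ∈ S) (hm k) hS).2 ?_
    filter_upwards [ae_restrict_mem measurableSet_Ico] with t ht using h t ht
  refine ⟨hprob, fun k => ?_, fun k => ?_⟩
  · refine hae k (Set.Ici 0) measurableSet_Ici fun t ht => ?_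
    exact quantileEffort_nonneg hθ hpos hc hv
      (Set.Ico_subset_Icc_self (quantileInterval_subset hp hp1 k ht))
  · have hμ := isProbabilityMeasure_effortLaw hp hp1 hprob
    set μ := effortLaw p (quantileStrategy p θ c v) with hμdef
    set x₀ := quantileEffort p θ c v (lowerMass p k)
    have hbest : ∀ t ∈ Set.Ico (lowerMass p k) (lowerMass p k + p k), ∀ x, 0 ≤ x →
        payoff (parametric θ c) p v (quantileStrategy p θ c v) k x ≤
          payoff (parametric θ c) p v (quantileStrategy p θ c v) k (quantileEffort p θ c v t) := by
      intro t ht x hx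
      have := payoff_le_payoff_quantileEffort hp hp1 hθ hpos hc hv hlt
        (quantileInterval_subset hp hp1 k ht) hx
      rwa [typeAt_eq hp hp1 ht.1 ht.2] at this
    have hk : lowerMass p k ∈ Set.Ico (lowerMass p k) (lowerMass p k + p k) :=
      ⟨le_rfl, by linarith [hp k]⟩
    set M := payoff (parametric θ c) p v (quantileStrategy p θ c v) k x₀ with hM
    have hpay : ∀ x, payoff (parametric θ c) p v (quantileStrategy p θ c v) k x =
        (prizePoly v).eval (μ.real (Set.Iic x)) - θ k * c x := fun x => by
      rw [payoff_eq, expectedPrize_eq hv]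
      rw [effortLaw_quantileStrategy hp hp1 hθ hpos hc hv]
      exact map_quantileEffort_singleton hθ hpos hc hv hlt x
    -- Transferring an almost-everywhere statement along the quantile map needs a measurable set:
    -- the nonnegative efforts earning at least the optimal payoff `M`. The `max` is there because
    -- `c` is arbitrary on negative arguments.
    have hcm : Continuous fun x => c (max x 0) :=
      hc.continuousOn.comp_continuous (continuous_id.max continuous_const)
        fun x => le_max_right x 0
    have hFm : Monotone fun x => μ.real (Set.Iic x) := fun a b hab =>
      measureReal_mono (Set.Iic_subset_Iic.2 hab)
    have hS : MeasurableSet {x | 0 ≤ x ∧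
        M ≤ (prizePoly v).eval (μ.real (Set.Iic x)) - θ k * c (max x 0)} := by
      have h2 : Measurable fun x =>
          (prizePoly v).eval (μ.real (Set.Iic x)) - θ k * c (max x 0) :=
        ((prizePoly v).continuous.measurable.comp hFm.measurable).sub (hcm.measurable.const_mul _)
      have h1 : MeasurableSet {x | M ≤ (prizePoly v).eval (μ.real (Set.Iic x)) -
          θ k * c (max x 0)} := measurableSet_le measurable_const h2
      exact measurableSet_Ici.inter h1
    have := hae k _ hS fun t ht => by
      have h0 := quantileEffort_nonneg (p := p) hθ hpos hc hv
        (Set.Ico_subset_Icc_self (quantileInterval_subset hp hp1 k ht))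
      refine ⟨h0, ?_⟩
      rw [max_eq_left h0, ← hpay]
      exact hbest t ht _ (quantileEffort_nonneg hθ hpos hc hv
        (Set.Ico_subset_Icc_self (quantileInterval_subset hp hp1 k hk)))
    filter_upwards [this] with x hx x' hx'
    obtain ⟨h0, h1⟩ := hx
    rw [max_eq_left h0, ← hpay] at h1
    exact (hbest _ hk x' hx').trans h1

lemma hasExpectedEffort_meanEffort (hp : ∀ k, 0 < p k) (hp1 : ∑ k, p k = 1)
    (hθ : StrictAnti θ) (hpos : ∀ k, 0 < θ k) (hc : IsCost c) (hv : Monotone v) :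
    HasExpectedEffort (parametric θ c) p v (meanEffort p θ c v) := by
  refine ⟨?_, fun σ hσ => hσ.mean_eq hp hp1 hθ hpos hc hv⟩
  rcases (hv (Fin.zero_le (Fin.last N))).lt_or_eq with hlt | heq
  · exact ⟨_, isSymmetricEquilibrium_quantileStrategy hp hp1 hθ hpos hc hv hlt⟩
  · exact ⟨_, isSymmetricEquilibrium_dirac hp hp1 hpos hc hv heq⟩

end existence

/-! ### Comparison with winner-takes-all. -/

/-- A subgradient `m` of a convex increasing function at `z`, in the form of a comparison of
increments on either side of `z`. -/
lemma exists_increment_slope {f : ℝ → ℝ} (hf : ConvexOn ℝ (Set.Ici 0) f)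
    (hmono : StrictMonoOn f (Set.Ici 0)) {z : ℝ} (hz : 0 < z) :
    ∃ m > 0, (∀ x y, z ≤ x → x ≤ y → m * (y - x) ≤ f y - f x) ∧
      (∀ x y, 0 ≤ x → x ≤ y → y ≤ z → f y - f x ≤ m * (y - x)) ∧
      (StrictConvexOn ℝ (Set.Ici 0) f → ∀ x y, z ≤ x → x < y → m * (y - x) < f y - f x) := by
  have hint : ∀ {x : ℝ}, 0 < x → x ∈ interior (Set.Ici (0 : ℝ)) := fun {x} hx => by
    rw [interior_Ici]; exact hx
  have hleft : ∀ x y, 0 ≤ x → x < y → y ≤ z →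
      slope f x y ≤ derivWithin f (Set.Ioi z) z := fun x y hx hxy hyz => by
    have hy : 0 < y := hx.trans_lt hxy
    calc slope f x y ≤ derivWithin f (Set.Iio y) y :=
          hf.slope_le_leftDeriv_of_mem_interior hx (hint hy) hxy
      _ ≤ derivWithin f (Set.Ioi y) y := hf.leftDeriv_le_rightDeriv_of_mem_interior (hint hy)
      _ ≤ _ := hf.monotoneOn_rightDeriv (hint hy) (hint hz) hyz
  -- The right derivative at `z` serves both sides, since it dominates the left derivative. It
  -- exists because `z > 0` is interior.
  refine ⟨derivWithin f (Set.Ioi z) z, ?_, ?_, ?_, ?_⟩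
  · refine lt_of_lt_of_le ?_ (hleft 0 z le_rfl hz le_rfl)
    rw [slope_def_field]
    exact div_pos (sub_pos.2 (hmono Set.self_mem_Ici hz.le hz)) (by linarith)
  · intro x y hzx hxy
    rcases hxy.eq_or_lt with rfl | hxy
    · simp
    · have hx : 0 < x := hz.trans_le hzx
      have h1 := (hf.monotoneOn_rightDeriv (hint hz) (hint hx) hzx).trans
        (hf.rightDeriv_le_slope_of_mem_interior (hint hx) (hx.trans hxy).le hxy)
      rwa [slope_def_field, le_div_iff₀ (by linarith)] at h1
  · intro x y hx hxy hyz
    rcases hxy.eq_or_lt with rfl | hxy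
    · simp
    · have h1 := hleft x y hx hxy hyz
      rwa [slope_def_field, div_le_iff₀ (by linarith)] at h1
  · intro hs x y hzx hxy
    have hx : 0 < x := hz.trans_le hzx
    have h1 := (hf.monotoneOn_rightDeriv (hint hz) (hint hx) hzx).trans_lt
      (StrictConvexOn.rightDeriv_lt_slope hs hx.le (hx.trans hxy).le hxy
        (hf.differentiableWithinAt_Ioi_of_mem_interior (hint hx)))
    rwa [slope_def_field, lt_div_iff₀ (by linarith)] at h1

lemma integral_pos_of_pos_near_one {f : ℝ → ℝ} (hf : IntervalIntegrable f volume 0 1)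
    (h0 : ∀ t ∈ Set.Icc (0 : ℝ) 1, 0 ≤ f t) {b : ℝ} (hb0 : 0 ≤ b) (hb : b < 1)
    (hpos : ∀ t ∈ Set.Ioo b 1, 0 < f t) : 0 < ∫ t in (0 : ℝ)..1, f t := by
  have h1 : IntervalIntegrable f volume 0 b := hf.mono_set (by
    rw [Set.uIcc_of_le hb0, Set.uIcc_of_le zero_le_one]; exact Set.Icc_subset_Icc_right hb.le)
  have h2 : IntervalIntegrable f volume b 1 := hf.mono_set (by
    rw [Set.uIcc_of_le hb.le, Set.uIcc_of_le zero_le_one]; exact Set.Icc_subset_Icc_left hb0)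
  rw [← intervalIntegral.integral_add_adjacent_intervals h1 h2]
  have h3 := intervalIntegral.intervalIntegral_pos_of_pos_on h2 hpos hb
  have h4 := intervalIntegral.integral_nonneg (μ := volume) hb0
    fun t ht => h0 t ⟨ht.1, ht.2.trans hb.le⟩
  linarith

lemma isContest_winnerTakesAll (N : ℕ) {V : ℝ} (hV : 0 ≤ V) : IsContest (winnerTakesAll N V) := by
  have hnn : ∀ m, 0 ≤ winnerTakesAll N V m := fun m => by
    unfold winnerTakesAll
    rw [Pi.single_apply]
    split_ifs <;> simp [hV]
  refine ⟨hnn 0, fun a b hab => ?_⟩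
  by_cases ha : a = Fin.last N
  · have hb : b = Fin.last N := le_antisymm (Fin.le_last b) (ha ▸ hab)
    rw [ha, hb]
  · have : winnerTakesAll N V a = 0 := Pi.single_eq_of_ne ha _
    rw [this]
    exact hnn b

lemma sum_winnerTakesAll (N : ℕ) (V : ℝ) : ∑ m, winnerTakesAll N V m = V := by
  simp [winnerTakesAll]

/-- A spread of at least `V` within the budget `V` forces the top prize to be `V` and all others to
vanish. -/
lemma IsContest.spread_lt_of_ne {n : ℕ} {v : Fin (n + 2) → ℝ} (hv : IsContest v) {V : ℝ}
    (hsum : ∑ m, v m ≤ V) (hne : v ≠ winnerTakesAll (n + 1) V) :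
    v (Fin.last (n + 1)) - v 0 < V := by
  have hnn : ∀ m, 0 ≤ v m := fun m => hv.nonneg.trans (hv.mono (Fin.zero_le m))
  by_contra! hcon
  refine hne (funext fun m => ?_)
  have hs := hsum
  rw [Fin.sum_univ_castSucc] at hs
  have hrest : 0 ≤ ∑ i : Fin (n + 1), v i.castSucc := Finset.sum_nonneg fun i _ => hnn _
  have h0 := hv.nonneg
  have hzero : ∑ i : Fin (n + 1), v i.castSucc = 0 := by linarith
  rw [Finset.sum_eq_zero_iff_of_nonneg fun i _ => hnn _] at hzero
  refine Fin.lastCases ?_ (fun i => ?_) m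
  · have : winnerTakesAll (n + 1) V (Fin.last (n + 1)) = V := Pi.single_eq_same _ _
    rw [this]
    linarith
  · have : winnerTakesAll (n + 1) V i.castSucc = 0 :=
      Pi.single_eq_of_ne (Fin.castSucc_lt_last i).ne _
    rw [this, hzero i (Finset.mem_univ _)]

section comparison
variable {n K : ℕ} [NeZero K] {p θ : Fin K → ℝ} {v : Fin (n + 2) → ℝ} {V : ℝ}

/-- Winner-takes-all shifts marginal prizes, and hence costs, to the able types. -/
lemma exists_cost_increment_le (hθ : StrictAnti θ) (hpos : ∀ k, 0 < θ k) (hv : Monotone v)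
    (hV : v (Fin.last (n + 1)) - v 0 ≤ V) :
    ∃ a ∈ Set.Icc (0 : ℝ) 1,
      (∀ t ∈ Set.Icc 0 a,
        scaledCost p θ (winnerTakesAll (n + 1) V) t ≤ scaledCost p θ v t) ∧
      (∀ s ∈ Set.Icc a 1, ∀ t ∈ Set.Icc a 1, s ≤ t →
        scaledCost p θ (winnerTakesAll (n + 1) V) s - scaledCost p θ v s ≤
          scaledCost p θ (winnerTakesAll (n + 1) V) t - scaledCost p θ v t) ∧
      ∀ s ∈ Set.Icc (0 : ℝ) 1, ∀ t ∈ Set.Icc (0 : ℝ) 1, s ≤ t →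
        ability p θ a * ((prizePoly (winnerTakesAll (n + 1) V) - prizePoly v).eval t -
            (prizePoly (winnerTakesAll (n + 1) V) - prizePoly v).eval s) ≤
          (scaledCost p θ (winnerTakesAll (n + 1) V) t - scaledCost p θ v t) -
            (scaledCost p θ (winnerTakesAll (n + 1) V) s - scaledCost p θ v s) := by
  set u := winnerTakesAll (n + 1) V with hu
  set P := prizePoly u - prizePoly v with hP
  set q : ℝ → ℝ := fun s => (Polynomial.derivative P).eval s with hq
  have hqc : Continuous q := (Polynomial.derivative P).continuous
  have hqs : ∀ s, q s = (Polynomial.derivative (prizePoly u)).eval s -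
      (Polynomial.derivative (prizePoly v)).eval s := fun s => by simp [hq, hP]
  -- At 1 only the top prize gap survives, and for `v` it is at most the spread, hence at most `V`.
  have hq1 : 0 ≤ q 1 := by
    rw [hqs, hu, derivative_prizePoly_winnerTakesAll, derivative_prizePoly,
      Polynomial.eval_finsetSum, Fin.sum_univ_castSucc, Finset.sum_eq_zero]
    · have h0 : v 0 ≤ v (Fin.last n).castSucc := hv (Fin.zero_le _)
      simp only [Polynomial.eval_mul, Polynomial.eval_C, Fin.val_last,
        bernsteinPolynomial.eval_at_1, if_true, one_pow, Fin.succ_last]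
      have : (0 : ℝ) ≤ (n + 1) * (V - (v (Fin.last (n + 1)) - v (Fin.last n).castSucc)) :=
        mul_nonneg (by positivity) (by linarith)
      linarith
    · intro m _
      rw [Polynomial.eval_mul, bernsteinPolynomial.eval_at_1, if_neg, mul_zero]
      simpa using m.2.ne
  obtain ⟨a, ha, hneg, hposq⟩ := exists_sign_change hqc hq1 fun s t hs hst ht h => by
    rw [hqs, sub_nonneg] at h ⊢
    exact marginal_single_crossing hv hs hst ht h
  have hD : ∀ s t, (scaledCost p θ u t - scaledCost p θ v t) -
      (scaledCost p θ u s - scaledCost p θ v s) = ∫ r in s..t, ability p θ r * q r := by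
    intro s t
    have e : ∀ x : Fin (n + 2) → ℝ, IntervalIntegrable (fun r => ability p θ r *
        (Polynomial.derivative (prizePoly x)).eval r) volume s t := fun x =>
      intervalIntegrable_ability_mul hθ hpos (Polynomial.derivative (prizePoly x)).continuous _ _
    calc _ = (scaledCost p θ u t - scaledCost p θ u s) -
          (scaledCost p θ v t - scaledCost p θ v s) := by ring
      _ = _ := by
        rw [scaledCost_sub hθ hpos, scaledCost_sub hθ hpos,
          ← intervalIntegral.integral_sub (e u) (e v)]
        simp only [hqs, mul_sub]
  have hint : ∀ s t, IntervalIntegrable (fun r => ability p θ r * q r) volume s t :=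
    intervalIntegrable_ability_mul hθ hpos hqc
  refine ⟨a, ha, ?_, ?_, ?_⟩
  · intro t ht
    have h1 := hD 0 t
    rw [scaledCost_zero, scaledCost_zero, sub_zero, sub_zero] at h1
    have h2 : ∫ r in (0 : ℝ)..t, ability p θ r * q r ≤ ∫ r in (0 : ℝ)..t, (0 : ℝ) := by
      refine intervalIntegral.integral_mono_on_of_le_Ioo ht.1 (hint _ _)
        intervalIntegrable_const fun r hr => ?_
      exact mul_nonpos_of_nonneg_of_nonpos (ability_pos p hpos r).le
        (hneg r ⟨hr.1.le, hr.2.trans_le ht.2⟩)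
    rw [intervalIntegral.integral_zero] at h2
    linarith
  · intro s hs t ht hst
    have h1 := hD s t
    have h2 : 0 ≤ ∫ r in s..t, ability p θ r * q r :=
      intervalIntegral.integral_nonneg hst fun r hr =>
        mul_nonneg (ability_pos p hpos r).le (hposq r ⟨hs.1.trans hr.1, hr.2.trans ht.2⟩)
    linarith
  · intro s hs t ht hst
    rw [hD, ← integral_derivative_eval, ← intervalIntegral.integral_const_mul]
    refine intervalIntegral.integral_mono_on hst
      ((hqc.const_mul _).intervalIntegrable _ _) (hint _ _) fun r hr => ?_
    -- Freezing the weight at its value at `a` lowers the integrand on both sides: it enlarges the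
    -- weight where `q ≤ 0` and reduces it where `q ≥ 0`.
    rcases lt_or_ge r a with hra | hra
    · exact mul_le_mul_of_nonpos_right (ability_mono p hθ hpos hra.le)
        (hneg r ⟨hs.1.trans hr.1, hra⟩)
    · exact mul_le_mul_of_nonneg_right (ability_mono p hθ hpos hra)
        (hposq r ⟨hra, hr.2.trans ht.2⟩)

/-- The costs of winner-takes-all exceed those of another contest on average, and cross them
once, from below. -/
lemma scaledCost_single_crossing (hp : ∀ k, 0 < p k) (hp1 : ∑ k, p k = 1) (hθ : StrictAnti θ)
    (hpos : ∀ k, 0 < θ k) (hv : IsContest v) (hsum : ∑ m, v m ≤ V)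
    (hne : v ≠ winnerTakesAll (n + 1) V) :
    (∃ τ ∈ Set.Icc (0 : ℝ) 1,
      (∀ t ∈ Set.Icc 0 τ,
        scaledCost p θ (winnerTakesAll (n + 1) V) t ≤ scaledCost p θ v t) ∧
      ∀ t ∈ Set.Icc τ 1,
        scaledCost p θ v t ≤ scaledCost p θ (winnerTakesAll (n + 1) V) t) ∧
    scaledCost p θ v 1 < scaledCost p θ (winnerTakesAll (n + 1) V) 1 ∧
    0 ≤ ∫ t in (0 : ℝ)..1, (scaledCost p θ (winnerTakesAll (n + 1) V) t - scaledCost p θ v t) ∧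
    (2 ≤ K → 0 < ∫ t in (0 : ℝ)..1,
      (scaledCost p θ (winnerTakesAll (n + 1) V) t - scaledCost p θ v t)) := by
  have hspread := hv.spread_lt_of_ne hsum hne
  obtain ⟨a, ha, hbelow, habove, hinc⟩ :=
    exists_cost_increment_le (p := p) hθ hpos hv.mono hspread.le
  set u := winnerTakesAll (n + 1) V with hu
  set P := prizePoly u - prizePoly v with hP
  set D : ℝ → ℝ := fun t => scaledCost p θ u t - scaledCost p θ v t with hD
  have hDc : Continuous D := (continuous_scaledCost hθ hpos).sub (continuous_scaledCost hθ hpos)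
  have hD0 : D 0 = 0 := by simp [hD, scaledCost_zero]
  have h0 : (0 : ℝ) ∈ Set.Icc (0 : ℝ) 1 := ⟨le_rfl, zero_le_one⟩
  have h1 : (1 : ℝ) ∈ Set.Icc (0 : ℝ) 1 := ⟨zero_le_one, le_rfl⟩
  have hu0 : u 0 = 0 := Pi.single_eq_of_ne (by simp [Fin.ext_iff]) _
  have hu1 : u (Fin.last (n + 1)) = V := Pi.single_eq_same _ _
  have hP1 : 0 < P.eval 1 - P.eval 0 := by
    simp only [hP, Polynomial.eval_sub, prizePoly_eval_zero, prizePoly_eval_one, hu0, hu1]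
    linarith
  have hwa := ability_pos p hpos a
  have hlow : ∀ t ∈ Set.Icc (0 : ℝ) 1, ability p θ a * (P.eval t - P.eval 0) ≤ D t := by
    intro t ht
    have := hinc 0 h0 t ht ht.1
    simp only [scaledCost_zero, sub_zero] at this
    exact this
  have hD1 : 0 < D 1 := lt_of_lt_of_le (mul_pos hwa hP1) (hlow 1 h1)
  have hRc : Continuous fun t => ability p θ a * (P.eval t - P.eval 0) :=
    (P.continuous.sub continuous_const).const_mul _
  -- The integral equals `ability p θ a` times (V - ∑ v_m)/(N + 1) + v_0, with N = n + 1.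
  have hRint : 0 ≤ ∫ t in (0 : ℝ)..1, ability p θ a * (P.eval t - P.eval 0) := by
    rw [intervalIntegral.integral_const_mul]
    refine mul_nonneg hwa.le ?_
    rw [intervalIntegral.integral_sub (P.continuous.intervalIntegrable _ _)
      intervalIntegrable_const, intervalIntegral.integral_const]
    simp only [hP, Polynomial.eval_sub, prizePoly_eval_zero, hu0]
    rw [intervalIntegral.integral_sub ((prizePoly u).continuous.intervalIntegrable _ _)
      ((prizePoly v).continuous.intervalIntegrable _ _), integral_prizePoly, integral_prizePoly,
      hu, sum_winnerTakesAll]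
    have h2 : (∑ m, v m) / ((n + 1 : ℕ) + 1 : ℝ) ≤ V / ((n + 1 : ℕ) + 1 : ℝ) :=
      div_le_div_of_nonneg_right hsum (by positivity)
    have h3 := hv.nonneg
    simp only [sub_zero, one_smul, zero_sub]
    linarith
  refine ⟨?_, sub_pos.1 hD1, ?_, ?_⟩
  · have hDa : D a ≤ 0 := sub_nonpos.2 (hbelow a ⟨ha.1, le_rfl⟩)
    obtain ⟨τ, hτ, hDτ⟩ := intermediate_value_Icc ha.2 hDc.continuousOn ⟨hDa, hD1.le⟩
    refine ⟨τ, ⟨ha.1.trans hτ.1, hτ.2⟩, fun t ht => ?_, fun t ht => ?_⟩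
    · rcases le_total t a with hta | hta
      · exact hbelow t ⟨ht.1, hta⟩
      · have : D t ≤ D τ := habove t ⟨hta, ht.2.trans hτ.2⟩ τ hτ ht.2
        exact sub_nonpos.1 (this.trans hDτ.le)
    · have : D τ ≤ D t := habove τ hτ t ⟨hτ.1.trans ht.1, ht.2⟩ ht.1
      exact sub_nonneg.1 (hDτ.ge.trans this)
  · exact hRint.trans (intervalIntegral.integral_mono_on zero_le_one
      (hRc.intervalIntegrable _ _) (hDc.intervalIntegrable _ _) hlow)
  · intro hK
    -- Equality at 1 would make the lower bound on `D` tight on all of `[0, 1]`. On the interval of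
    -- a type other than the one at `a`, the increments of `P` would then agree after multiplication
    -- by two different weights, so `P` would be constant there, hence everywhere, against `hP1`.
    have hstrict : ability p θ a * (P.eval 1 - P.eval 0) < D 1 := by
      by_contra! hcon
      have heq : ∀ t ∈ Set.Icc (0 : ℝ) 1, D t = ability p θ a * (P.eval t - P.eval 0) := by
        intro t ht
        have e1 := hlow t ht
        have e2 := hinc t ht 1 h1 ht.2
        have e3 : D 1 - D t = (scaledCost p θ u 1 - scaledCost p θ v 1) -
          (scaledCost p θ u t - scaledCost p θ v t) := rfl
        nlinarith
      have : Nontrivial (Fin K) := Fin.nontrivial_iff_two_le.2 hK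
      obtain ⟨k, hk⟩ := exists_ne (typeAt p a)
      have hsub : ∀ t ∈ Set.Ico (lowerMass p k) (lowerMass p k + p k),
          P.eval t = P.eval (lowerMass p k) := by
        intro t ht
        have hlk : lowerMass p k ∈ Set.Ico (lowerMass p k) (lowerMass p k + p k) :=
          ⟨le_rfl, by linarith [hp k]⟩
        have ht' := Set.Ico_subset_Icc_self (quantileInterval_subset hp hp1 k ht)
        have hk' := Set.Ico_subset_Icc_self (quantileInterval_subset hp hp1 k hlk)
        have eu := scaledCost_rateBetween (v := u) p
          (isContest_winnerTakesAll (n + 1) (by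
            have := hv.mono (Fin.zero_le (Fin.last (n + 1))); linarith)).mono hθ hpos _ hk' t ht'
            ht.1
        have ev := scaledCost_rateBetween p hv.mono hθ hpos _ hk' t ht' ht.1
        simp only [ability, typeAt_eq hp hp1 ht.1 ht.2, typeAt_eq hp hp1 hlk.1 hlk.2] at eu ev
        have e1 := heq t ht'
        have e2 := heq _ hk'
        have e3 : (θ k)⁻¹ * (P.eval t - P.eval (lowerMass p k)) =
            ability p θ a * (P.eval t - P.eval (lowerMass p k)) := by
          have e4 : P.eval t - P.eval (lowerMass p k) =
              ((prizePoly u).eval t - (prizePoly u).eval (lowerMass p k)) -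
              ((prizePoly v).eval t - (prizePoly v).eval (lowerMass p k)) := by
            simp only [hP, Polynomial.eval_sub]; ring
          have e5 : (θ k)⁻¹ * (P.eval t - P.eval (lowerMass p k)) = D t - D (lowerMass p k) := by
            rw [e4, mul_sub]
            simp only [hD]
            linarith [eu.1, eu.2, ev.1, ev.2]
          rw [e5, e1, e2]
          ring
        have hne' : (θ k)⁻¹ ≠ ability p θ a := by
          rw [ability, Ne, inv_inj]
          exact fun h => hk (hθ.injective h)
        have := mul_eq_zero.1 ((sub_mul _ _ _).trans (sub_eq_zero.2 e3))
        rcases this with h | h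
        · exact absurd (sub_eq_zero.1 h) hne'
        · exact sub_eq_zero.1 h
      have hPc : P = Polynomial.C (P.eval (lowerMass p k)) := by
        refine Polynomial.eq_of_infinite_eval_eq _ _
          ((Set.Ico_infinite (by linarith [hp k] :
            lowerMass p k < lowerMass p k + p k)).mono fun t ht => ?_)
        simp only [Set.mem_ofPred_eq, Polynomial.eval_C]
        exact hsub t ht
      rw [hPc] at hP1
      simp at hP1
    have hpos' := intervalIntegral.integral_pos (zero_lt_one (α := ℝ))
      (hDc.sub hRc).continuousOn (fun t ht => sub_nonneg.2 (hlow t ⟨ht.1.le, ht.2⟩))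
      ⟨1, h1, sub_pos.2 hstrict⟩
    simp only [Pi.sub_apply] at hpos'
    rw [intervalIntegral.integral_sub (hDc.intervalIntegrable _ _)
      (hRc.intervalIntegrable _ _)] at hpos'
    linarith

lemma meanEffort_lt_winnerTakesAll {c : ℝ → ℝ} (hp : ∀ k, 0 < p k) (hp1 : ∑ k, p k = 1)
    (hθ : StrictAnti θ) (hpos : ∀ k, 0 < θ k) (hc : IsCost c)
    (hconc : ConcaveOn ℝ (Set.Ici 0) c) (hstrict : 2 ≤ K ∨ StrictConcaveOn ℝ (Set.Ici 0) c)
    (hV : 0 ≤ V) (hv : IsContest v) (hsum : ∑ m, v m ≤ V)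
    (hne : v ≠ winnerTakesAll (n + 1) V) :
    meanEffort p θ c v < meanEffort p θ c (winnerTakesAll (n + 1) V) := by
  obtain ⟨⟨τ, hτ, hle, hge⟩, hone, hint0, hintK⟩ :=
    scaledCost_single_crossing hp hp1 hθ hpos hv hsum hne
  have hu := isContest_winnerTakesAll (n + 1) hV
  set u := winnerTakesAll (n + 1) V
  set φ := costInv c
  have hφ : StrictMonoOn φ (Set.Ici 0) := hc.costInv_strictMonoOn
  have hv0 : ∀ t ∈ Set.Icc (0 : ℝ) 1, 0 ≤ scaledCost p θ v t := fun t ht =>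
    scaledCost_nonneg p hv.mono hθ hpos ht
  have hu0 : ∀ t ∈ Set.Icc (0 : ℝ) 1, 0 ≤ scaledCost p θ u t := fun t ht =>
    scaledCost_nonneg p hu.mono hθ hpos ht
  have hvi := intervalIntegrable_quantileEffort p hc hv.mono hθ hpos
  have hui := intervalIntegrable_quantileEffort p hc hu.mono hθ hpos
  have hDc : Continuous fun t => scaledCost p θ u t - scaledCost p θ v t :=
    (continuous_scaledCost hθ hpos).sub (continuous_scaledCost hθ hpos)
  obtain ⟨b, hb, hb1, hbpos⟩ : ∃ b, τ ≤ b ∧ b < 1 ∧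
      ∀ t ∈ Set.Ioo b 1, scaledCost p θ v t < scaledCost p θ u t := by
    have hτ1 : τ < 1 := by
      refine lt_of_le_of_ne hτ.2 fun h => ?_
      exact absurd (hle 1 ⟨zero_le_one, h.ge⟩) (not_le.2 hone)
    have hev : ∀ᶠ t in nhdsWithin (1 : ℝ) (Set.Iio 1),
        0 < scaledCost p θ u t - scaledCost p θ v t :=
      ((hDc.tendsto 1).mono_left nhdsWithin_le_nhds).eventually (lt_mem_nhds (sub_pos.2 hone))
    obtain ⟨l, hl, hl'⟩ := (mem_nhdsLT_iff_exists_Ioo_subset).1 hev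
    exact ⟨max τ l, le_max_left _ _, max_lt hτ1 hl, fun t ht =>
      sub_pos.1 (hl' ⟨(le_max_right _ _).trans_lt ht.1, ht.2⟩)⟩
  have hττ : scaledCost p θ u τ = scaledCost p θ v τ :=
    le_antisymm (hle τ ⟨hτ.1, le_rfl⟩) (hge τ ⟨le_rfl, hτ.2⟩)
  have hmv := scaledCost_monotoneOn p hv.mono hθ hpos
  have hmu := scaledCost_monotoneOn p hu.mono hθ hpos
  rw [← sub_pos, meanEffort, meanEffort, ← intervalIntegral.integral_sub hui hvi]
  -- At cost zero no two-sided slope is available. But then the cost under `v` vanishes up to τ, so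
  -- winner-takes-all is at least as costly at every quantile.
  rcases (hv0 τ hτ).eq_or_lt with hz | hz
  · refine integral_pos_of_pos_near_one
      (f := fun t => quantileEffort p θ c u t - quantileEffort p θ c v t) (hui.sub hvi)
      (fun t ht => ?_) (hτ.1.trans hb) hb1 fun t ht => ?_
    · have h1 : scaledCost p θ v t ≤ scaledCost p θ u t := by
        rcases le_total τ t with h | h
        · exact hge t ⟨h, ht.2⟩
        · have := hmv ht hτ h
          rw [← hz] at this
          exact this.trans (hu0 t ht)
      exact sub_nonneg.2 (hφ.monotoneOn (hv0 t ht) (hu0 t ht) h1)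
    · have ht' : t ∈ Set.Icc (0 : ℝ) 1 := ⟨(hτ.1.trans hb).trans ht.1.le, ht.2.le⟩
      exact sub_pos.2 (hφ (hv0 t ht') (hu0 t ht') (hbpos t ht))
  · obtain ⟨m, hm, hright, hleft, hsc⟩ :=
      exists_increment_slope (hc.convexOn_costInv hconc) hφ hz
    -- Right of τ both costs are at least the crossing value and their difference is nonnegative;
    -- left of τ both are at most that value and the sign is reversed. In either case convexity
    -- bounds the effort difference below by `m` times the cost difference.
    have hpt : ∀ t ∈ Set.Icc (0 : ℝ) 1, m * (scaledCost p θ u t - scaledCost p θ v t) ≤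
        quantileEffort p θ c u t - quantileEffort p θ c v t := by
      intro t ht
      rcases le_total τ t with h | h
      · exact hright _ _ (hmv hτ ht h) (hge t ⟨h, ht.2⟩)
      · have := hleft _ _ (hu0 t ht) (hle t ⟨ht.1, h⟩) (hmv ht hτ h)
        simp only [quantileEffort]
        linarith
    have hmi : IntervalIntegrable
        (fun t => m * (scaledCost p θ u t - scaledCost p θ v t)) volume 0 1 :=
      (hDc.const_mul m).intervalIntegrable _ _
    rcases hstrict with hK | hs
    · have h1 := intervalIntegral.integral_mono_on zero_le_one hmi (hui.sub hvi) hpt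
      rw [intervalIntegral.integral_const_mul] at h1
      exact lt_of_lt_of_le (mul_pos hm (hintK hK)) h1
    · have h1 := integral_pos_of_pos_near_one
        (f := fun t => (quantileEffort p θ c u t - quantileEffort p θ c v t) -
          m * (scaledCost p θ u t - scaledCost p θ v t)) ((hui.sub hvi).sub hmi)
        (fun t ht => sub_nonneg.2 (hpt t ht)) (hτ.1.trans hb) hb1 fun t ht => by
          have ht' : t ∈ Set.Icc (0 : ℝ) 1 := ⟨(hτ.1.trans hb).trans ht.1.le, ht.2.le⟩
          exact sub_pos.2 (hsc (hc.strictConvexOn_costInv hs) _ _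
            (hmv hτ ht' (hb.trans ht.1.le)) (hbpos t ht))
      rw [intervalIntegral.integral_sub (hui.sub hvi) hmi,
        intervalIntegral.integral_const_mul] at h1
      have h2 := mul_nonneg hm.le hint0
      linarith

end comparison

end Contest

end

theorem mainTheorem2 (N K : ℕ) (hN : 1 ≤ N)
    (p : Fin K → ℝ) (hp : ∀ k, 0 < p k) (hp1 : ∑ k, p k = 1)
    (θ : Fin K → ℝ) (hθ : StrictAnti θ) (hθpos : ∀ k, 0 < θ k)
    (c : ℝ → ℝ) (hc : Contest.IsCost c) (hconc : ConcaveOn ℝ (Set.Ici 0) c)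
    (hstrict : 2 ≤ K ∨ StrictConcaveOn ℝ (Set.Ici 0) c)
    (V : ℝ) (hV : 0 < V) :
    ∃ E : (Fin (N + 1) → ℝ) → ℝ,
      (∀ v, Contest.IsContest v →
        Contest.HasExpectedEffort (Contest.parametric θ c) p v (E v)) ∧
      Contest.IsContest (Contest.winnerTakesAll N V) ∧
      ∑ m, Contest.winnerTakesAll N V m ≤ V ∧
      ∀ v, Contest.IsContest v → ∑ m, v m ≤ V → v ≠ Contest.winnerTakesAll N V →
        E v < E (Contest.winnerTakesAll N V) := by
  have hK : NeZero K := ⟨by rintro rfl; simp at hp1⟩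
  obtain ⟨n, rfl⟩ : ∃ n, N = n + 1 := ⟨N - 1, by omega⟩
  exact ⟨Contest.meanEffort p θ c,
    fun v hv => Contest.hasExpectedEffort_meanEffort hp hp1 hθ hθpos hc hv.mono,
    Contest.isContest_winnerTakesAll _ hV.le, (Contest.sum_winnerTakesAll _ V).le,
    fun v hv hsum hne =>
      Contest.meanEffort_lt_winnerTakesAll hp hp1 hθ hθpos hc hconc hstrict hV.le hv hsum hne⟩
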